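/- Let $d\ge 1$. A fusion rule $\mathcal R$ in $\mathbb R^d$ (with translations as the group of motions) consists of finite sets $\mathcal P_n=\{P_n(1),\dots,P_n(j_n)\}$, $n\ge 0$, where the elements of $\mathcal P_0$ are labelled closed topological disks in $\mathbb R^d$ (the prototiles; a tile is a translate of one of them) and, for $n\ge 0$, each $(n+1)$-supertile $P_{n+1}(l)$ is a patch of translated $n$-supertiles, i.e. a finite collection with connected union whose members overlap only on their boundaries. One such decomposition is fixed for every $P_{n+1}(l)$. For $k\ge 0$ let $X^k_{\mathcal R}$ be the space of tilings of $\mathbb R^d$ by translated, labelled $k$-supertiles all of whose patches (of $k$-supertiles) occur, up to translation, in the decomposition into $k$-supertiles of some $P_N(j)$, with the topology in which two tilings are $\epsilon$-close if after translations of length at most $\epsilon$ they agree on the ball of radius $1/\epsilon$ about the origin; $X_{\mathcal R}=X^0_{\mathcal R}$. Assume that $X_{\mathcal R}\ne\emptyset$ and that every tiling in $X_{\mathcal R}$ has finite local complexity (it contains, up to translation, only finitely many connected two-tile patches). Suppose that $\mathcal R$ is * primitive: for every $n$ there is $N>n$ such that every $N$-supertile contains (in its decomposition into $n$-supertiles)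 every $n$-supertile; * van Hove: for every choice of one $n$-supertile for each $n$, with supports $A_n$, and every $r\ge0$, $\mathrm{Vol}(\{x:\mathrm{dist}(x,\partial A_n)\le r\})/\mathrm{Vol}(A_n)\to 0$ as $n\to\infty$; * recognizable: for every $n$, the subdivision map $X^{n+1}_{\mathcal R}\to X^{n}_{\mathcal R}$, which breaks each $(n+1)$-supertile into its $n$-supertiles, is a homeomorphism. Let $M_{n,n+1}(k,l)$ be the number of $n$-supertiles of type $k$ in $P_{n+1}(l)$, let $M_{n,N}=M_{n,n+1}M_{n+1,n+2}\cdots M_{N-1,N}$ for $n<N$, and let $$D_{n,N}(i,k)=\frac{M_{n,N}(i,k)}{\sum_{l=1}^{j_n}M_{n,N}(l,k)\,\mathrm{Vol}(P_n(l))}.$$ Theorem. The dynamical system $(X_{\mathcal R},\mathbb R^d)$, where $\mathbb R^d$ acts by translations, is uniquely ergodic (it has exactly one ergodic invariant Borel probability measure) if and only if for every $n$ the matrices $D_{n,N}$ are asymptotically rank one, i.e. there is a vector $d_n\in\mathbb R^{j_n}$ such that the columns of $D_{n,N}$ all approach $d_n$ as $N\to\infty$, uniformly over the columns. -/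

import Mathlib

open MeasureTheory Set Filter Topology
open scoped Pointwise

/-- Physical space `ℝ^d` with its Euclidean norm. -/
abbrev Space (d : ℕ) : Type := EuclideanSpace ℝ (Fin d)

/-- Two sets overlap only on their boundaries. -/
def NonOverlap {d : ℕ} (A B : Set (Space d)) : Prop :=
  A ∩ B ⊆ frontier A ∩ frontier B

/-- A copy of the (labelled) building block number `idx`, translated by the vector `pos`. -/
@[ext]
structure Placed (J d : ℕ) where
  idx : Fin J
  pos : Space d

/-- `ℝ^d` acts on tiles by translation, and carries the label along. Through Mathlib's pointwise
action it also acts on sets of tiles. -/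
instance Placed.instAddAction (J d : ℕ) : AddAction (Space d) (Placed J d) where
  vadd v t := ⟨t.idx, v + t.pos⟩
  zero_vadd _ := Placed.ext rfl (zero_add _)
  add_vadd u v t := Placed.ext rfl (add_assoc u v t.pos)

/-- The combinatorial data of a fusion rule with group `ℝ^d`: for every level `n` the number `J n`
of `n`-supertiles `P_n(j)`, the sets that carry the prototiles (the label of a prototile is its
index), and for each `(n+1)`-supertile the chosen way in which it is put together from translated
`n`-supertiles. -/
structure FusionData (d : ℕ) where
  J : ℕ → ℕ
  prototile : Fin (J 0) → Set (Space d)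
  comp : ∀ n, Fin (J (n + 1)) → Finset (Placed (J n) d)

namespace FusionData

variable {d : ℕ}

/-- The set covered by the supertile `P_n(j)`. -/
def supp (R : FusionData d) : (n : ℕ) → Fin (R.J n) → Set (Space d)
  | 0, j => R.prototile j
  | n + 1, j => ⋃ p ∈ R.comp n j, p.pos +ᵥ supp R n p.idx

/-- The set covered by a translated `n`-supertile. -/
def tileSupp (R : FusionData d) (n : ℕ) (t : Placed (R.J n) d) : Set (Space d) :=
  t.pos +ᵥ R.supp n t.idx

/-- The tiles in the collection `Q` overlap only on their boundaries. -/
def IsPacking (R : FusionData d) (n : ℕ) (Q : Set (Placed (R.J n) d)) : Prop :=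
  Q.Pairwise fun s t => NonOverlap (R.tileSupp n s) (R.tileSupp n t)

/-- A patch of `n`-supertiles: a finite collection with connected (nonempty) support, whose
members overlap only on their boundaries. For `n = 0` this is a patch of tiles. -/
def IsPatch (R : FusionData d) (n : ℕ) (Q : Set (Placed (R.J n) d)) : Prop :=
  Q.Finite ∧ IsConnected (⋃ t ∈ Q, R.tileSupp n t) ∧ R.IsPacking n Q

/-- `R.Occurs k N j t`: the placed `k`-supertile `t` is one of the `k`-supertiles into which
the `N`-supertile `P_N(j)` decomposes under the chosen fusions. -/
inductive Occurs (R : FusionData d) (k : ℕ) : (N : ℕ) → Fin (R.J N) → Placed (R.J k) d → Prop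
  | self (j : Fin (R.J k)) : Occurs R k k j ⟨j, 0⟩
  | step {N : ℕ} (j : Fin (R.J (N + 1))) (p : Placed (R.J N) d) (hp : p ∈ R.comp N j)
      (t : Placed (R.J k) d) (ht : Occurs R k N p.idx t) : Occurs R k (N + 1) j (p.pos +ᵥ t)

/-- A translate of the collection `Q` of `k`-supertiles is found inside some supertile. -/
def Admitted (R : FusionData d) (k : ℕ) (Q : Set (Placed (R.J k) d)) : Prop :=
  ∃ (N : ℕ) (j : Fin (R.J N)) (v : Space d), v +ᵥ Q ⊆ {t | R.Occurs k N j t}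

end FusionData

/-- A fusion rule in `ℝ^d`, with translations as the group of motions: the prototiles are closed
topological disks, and each `(n+1)`-supertile is a patch of `n`-supertiles. -/
structure FusionRule (d : ℕ) extends FusionData d where
  disk : ∀ j, Nonempty (Metric.closedBall (0 : Space d) 1 ≃ₜ prototile j)
  comp_isPatch : ∀ n j, toFusionData.IsPatch n (comp n j : Set (Placed (J n) d))

/-- A point of the space `X^k_R`: a tiling of `ℝ^d` by `k`-supertiles (these being the smallest
building blocks), all of whose patches are admitted. `X_R` is the case `k = 0`. -/
@[ext]
structure FusionTiling {d : ℕ} (R : FusionRule d) (k : ℕ) where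
  tiles : Set (Placed (R.J k) d)
  covers : ⋃ t ∈ tiles, R.tileSupp k t = univ
  packing : R.IsPacking k tiles
  admitted : ∀ Q ⊆ tiles, R.IsPatch k Q → R.Admitted k Q

section Translation

variable {d : ℕ}

theorem frontier_translate (v : Space d) (A : Set (Space d)) :
    frontier (v +ᵥ A) = v +ᵥ frontier A :=
  ((Homeomorph.vadd v : Space d ≃ₜ Space d).image_frontier A).symm

theorem NonOverlap.translate {A B : Set (Space d)} (h : NonOverlap A B) (v : Space d) :
    NonOverlap (v +ᵥ A) (v +ᵥ B) := by
  unfold NonOverlap at *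
  rw [frontier_translate, frontier_translate, ← Set.vadd_set_inter, ← Set.vadd_set_inter]
  exact Set.vadd_set_mono h

theorem NonOverlap.mono {A B A' B' : Set (Space d)} (h : NonOverlap A B) (hA : A' ⊆ A)
    (hB : B' ⊆ B) : NonOverlap A' B' := fun _ hx =>
  ⟨⟨subset_closure hx.1, fun hi => (h ⟨hA hx.1, hB hx.2⟩).1.2 (interior_mono hA hi)⟩,
    ⟨subset_closure hx.2, fun hi => (h ⟨hA hx.1, hB hx.2⟩).2.2 (interior_mono hB hi)⟩⟩

namespace FusionData

variable (R : FusionData d)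

theorem tileSupp_vadd (k : ℕ) (v : Space d) (t : Placed (R.J k) d) :
    R.tileSupp k (v +ᵥ t) = v +ᵥ R.tileSupp k t :=
  add_vadd v t.pos (R.supp k t.idx)

theorem iUnion_vadd (k : ℕ) (v : Space d) (Q : Set (Placed (R.J k) d)) :
    ⋃ t ∈ v +ᵥ Q, R.tileSupp k t = v +ᵥ ⋃ t ∈ Q, R.tileSupp k t := by
  rw [Set.vadd_set_iUnion₂]
  simp only [← Set.image_vadd, Set.biUnion_image]
  simp only [tileSupp_vadd, Set.image_vadd]

theorem IsPacking.vadd {k : ℕ} {Q : Set (Placed (R.J k) d)} (h : R.IsPacking k Q)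
    (v : Space d) : R.IsPacking k (v +ᵥ Q) := by
  rintro _ ⟨s, hs, rfl⟩ _ ⟨t, ht, rfl⟩ hst
  change NonOverlap (R.tileSupp k (v +ᵥ s)) (R.tileSupp k (v +ᵥ t))
  rw [tileSupp_vadd, tileSupp_vadd]
  exact (h hs ht fun e => hst (by rw [e])).translate v

theorem IsPatch.vadd {k : ℕ} {Q : Set (Placed (R.J k) d)} (h : R.IsPatch k Q)
    (v : Space d) : R.IsPatch k (v +ᵥ Q) := by
  refine ⟨h.1.image _, ?_, h.2.2.vadd R v⟩
  rw [iUnion_vadd]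
  exact h.2.1.image _ (continuous_const_vadd v).continuousOn

theorem Admitted.of_vadd {k : ℕ} {Q : Set (Placed (R.J k) d)} {v : Space d}
    (h : R.Admitted k (v +ᵥ Q)) : R.Admitted k Q := by
  obtain ⟨N, j, w, h⟩ := h
  exact ⟨N, j, w + v, by rwa [add_vadd]⟩

end FusionData

/-- The action of `ℝ^d` on `X^k_R` by translations. -/
instance FusionTiling.instAddAction (R : FusionRule d) (k : ℕ) :
    AddAction (Space d) (FusionTiling R k) where
  vadd v T :=
    { tiles := v +ᵥ T.tiles
      covers := by rw [FusionData.iUnion_vadd, T.covers, Set.vadd_set_univ]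
      packing := T.packing.vadd _ v
      admitted := fun Q hQ hp => by
        refine FusionData.Admitted.of_vadd (v := -v) _ (T.admitted _ ?_ (hp.vadd _ (-v)))
        rw [← neg_vadd_vadd v T.tiles]
        exact Set.vadd_set_mono hQ }
  zero_vadd T := FusionTiling.ext (zero_vadd _ T.tiles)
  add_vadd u v T := FusionTiling.ext (add_vadd u v T.tiles)

end Translation

section Topology

variable {d : ℕ} {R : FusionRule d} {k : ℕ}

/-- The members of the collection `T` that meet the closed ball of radius `r` about the origin. -/
def FusionData.patchAt (R : FusionData d) (k : ℕ) (r : ℝ) (T : Set (Placed (R.J k) d)) :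
    Set (Placed (R.J k) d) :=
  {t ∈ T | (R.tileSupp k t ∩ Metric.closedBall 0 r).Nonempty}

/-- `ε`-closeness in the big ball metric: after translations by vectors of length at most `ε` the
two tilings agree on the ball of radius `1/ε` about the origin. -/
def FusionTiling.Close (ε : ℝ) (T T' : FusionTiling R k) : Prop :=
  ∃ g g' : Space d, ‖g‖ ≤ ε ∧ ‖g'‖ ≤ ε ∧
    R.patchAt k (1 / ε) (g +ᵥ T.tiles) = R.patchAt k (1 / ε) (g' +ᵥ T'.tiles)

theorem FusionTiling.Close.mono {ε δ : ℝ} (hε : 0 < ε) (hεδ : ε ≤ δ) {T T' : FusionTiling R k}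
    (h : T.Close ε T') : T.Close δ T' := by
  obtain ⟨g, g', hg, hg', h⟩ := h
  have key : ∀ S : Set (Placed (R.J k) d),
      R.patchAt k (1 / δ) S = R.patchAt k (1 / δ) (R.patchAt k (1 / ε) S) := fun S => by
    ext t
    refine ⟨fun ht => ⟨⟨ht.1, ht.2.mono ?_⟩, ht.2⟩, fun ht => ⟨ht.1.1, ht.2⟩⟩
    exact inter_subset_inter_right _
      (Metric.closedBall_subset_closedBall (one_div_le_one_div_of_le hε hεδ))
  exact ⟨g, g', hg.trans hεδ, hg'.trans hεδ, by rw [key, h, ← key]⟩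

/-- The topology of the big ball metric. -/
instance FusionTiling.instTopologicalSpace : TopologicalSpace (FusionTiling R k) where
  IsOpen S := ∀ T ∈ S, ∃ ε > 0, ∀ T', FusionTiling.Close ε T T' → T' ∈ S
  isOpen_univ := fun _ _ => ⟨1, one_pos, fun _ _ => trivial⟩
  isOpen_inter := fun S S' h h' T hT => by
    obtain ⟨ε, hε, H⟩ := h T hT.1
    obtain ⟨δ, hδ, H'⟩ := h' T hT.2
    exact ⟨min ε δ, lt_min hε hδ, fun T' hT' =>
      ⟨H T' (hT'.mono (lt_min hε hδ) (min_le_left _ _)),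
        H' T' (hT'.mono (lt_min hε hδ) (min_le_right _ _))⟩⟩
  isOpen_sUnion := fun 𝒮 h T ⟨S, hS, hT⟩ => by
    obtain ⟨ε, hε, H⟩ := h S hS T hT
    exact ⟨ε, hε, fun T' hT' => ⟨S, hS, H T' hT'⟩⟩

/-- The Borel `σ`-algebra. -/
instance FusionTiling.instMeasurableSpace : MeasurableSpace (FusionTiling R k) := borel _

instance FusionTiling.instBorelSpace : BorelSpace (FusionTiling R k) := ⟨rfl⟩

end Topology

section Subdivision

variable {d : ℕ}

/-- Replace each `(n+1)`-supertile in a collection by the `n`-supertiles that compose it. -/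
def FusionData.subdivide (R : FusionData d) (n : ℕ) (T : Set (Placed (R.J (n + 1)) d)) :
    Set (Placed (R.J n) d) :=
  ⋃ t ∈ T, t.pos +ᵥ (R.comp n t.idx : Set (Placed (R.J n) d))

theorem FusionData.mem_subdivide {R : FusionData d} {n : ℕ} {T : Set (Placed (R.J (n + 1)) d)}
    {s : Placed (R.J n) d} :
    s ∈ R.subdivide n T ↔ ∃ t ∈ T, ∃ p ∈ R.comp n t.idx, t.pos +ᵥ p = s := by
  simp [FusionData.subdivide, Set.mem_vadd_set]

theorem FusionData.tileSupp_succ (R : FusionData d) (n : ℕ) (t : Placed (R.J (n + 1)) d) :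
    R.tileSupp (n + 1) t = ⋃ p ∈ R.comp n t.idx, R.tileSupp n (t.pos +ᵥ p) := by
  simp only [tileSupp_vadd]
  exact Set.vadd_set_iUnion₂ t.pos fun p (_ : p ∈ R.comp n t.idx) => R.tileSupp n p

theorem FusionData.tileSupp_subset {R : FusionData d} {n : ℕ} {t : Placed (R.J (n + 1)) d}
    {p : Placed (R.J n) d} (hp : p ∈ R.comp n t.idx) :
    R.tileSupp n (t.pos +ᵥ p) ⊆ R.tileSupp (n + 1) t := by
  rw [R.tileSupp_succ n t]
  exact subset_biUnion_of_mem (u := fun p => R.tileSupp n (t.pos +ᵥ p)) hp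

theorem FusionData.Occurs.sub {R : FusionData d} {n N : ℕ} {j : Fin (R.J N)}
    {s : Placed (R.J (n + 1)) d} (h : R.Occurs (n + 1) N j s) {q : Placed (R.J n) d}
    (hq : q ∈ R.comp n s.idx) : R.Occurs n N j (s.pos +ᵥ q) := by
  induction h with
  | self j =>
    have := Occurs.step j q hq ⟨q.idx, 0⟩ (Occurs.self q.idx)
    convert this using 1
    exact Placed.ext rfl ((zero_add _).trans (add_zero _).symm)
  | step j p hp t ht ih =>
    have := Occurs.step j p hp _ (ih hq)
    rwa [← add_vadd] at this

theorem FusionRule.isConnected_tileSupp (R : FusionRule d) (n : ℕ) (t : Placed (R.J (n + 1)) d) :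
    IsConnected (R.tileSupp (n + 1) t) :=
  (R.comp_isPatch n t.idx).2.1.image _ (continuous_const_vadd t.pos).continuousOn

/-- The supertiles of a tiling that contain the members of a connected collection of
lower-level supertiles form a connected collection. -/
theorem isConnected_parents {α β : Type*} {Q : Set α} {f : α → Set (Space d)} {par : α → β}
    {g : β → Set (Space d)} (hQ : IsConnected (⋃ s ∈ Q, f s)) (hf : ∀ s ∈ Q, f s ⊆ g (par s))
    (hne : ∀ s ∈ Q, (f s).Nonempty) (hg : ∀ s ∈ Q, IsConnected (g (par s))) :
    IsConnected (⋃ t ∈ par '' Q, g t) := by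
  obtain ⟨x, hx⟩ := hQ.nonempty
  have hsub : (⋃ s ∈ Q, f s) ⊆ ⋃ t ∈ par '' Q, g t := by
    rw [Set.biUnion_image]
    exact Set.iUnion₂_mono hf
  refine ⟨⟨x, hsub hx⟩, isPreconnected_of_forall x fun y hy => ?_⟩
  rw [Set.biUnion_image] at hy
  obtain ⟨s, hs, hy⟩ := Set.mem_iUnion₂.1 hy
  obtain ⟨z, hz⟩ := hne s hs
  refine ⟨(⋃ s ∈ Q, f s) ∪ g (par s), union_subset hsub ?_, Or.inl hx, Or.inr hy, ?_⟩
  · exact subset_biUnion_of_mem (u := g) (mem_image_of_mem par hs)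
  · exact hQ.isPreconnected.union z (Set.mem_iUnion₂.2 ⟨s, hs, hz⟩) (hf s hs hz)
      (hg s hs).isPreconnected

theorem FusionRule.nonempty_supp (R : FusionRule d) : ∀ n j, (R.supp n j).Nonempty
  | 0, j => by
    obtain ⟨h⟩ := R.disk j
    exact ⟨_, (h ⟨0, Metric.mem_closedBall_self zero_le_one⟩).2⟩
  | n + 1, j => (R.comp_isPatch n j).2.1.nonempty

/-- The subdivision map `X^{n+1}_R → X^n_R`. -/
def FusionRule.subdivisionMap (R : FusionRule d) (n : ℕ) (T : FusionTiling R (n + 1)) :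
    FusionTiling R n where
  tiles := R.subdivide n T.tiles
  covers := by
    refine Set.eq_univ_of_forall fun x => ?_
    have hx : x ∈ ⋃ t ∈ T.tiles, R.tileSupp (n + 1) t := T.covers ▸ mem_univ x
    obtain ⟨t, ht, hx⟩ := Set.mem_iUnion₂.1 hx
    rw [R.tileSupp_succ] at hx
    obtain ⟨p, hp, hx⟩ := Set.mem_iUnion₂.1 hx
    exact Set.mem_iUnion₂.2 ⟨_, FusionData.mem_subdivide.2 ⟨t, ht, p, hp, rfl⟩, hx⟩
  packing := by
    intro a ha b hb hab
    obtain ⟨t, ht, p, hp, rfl⟩ := FusionData.mem_subdivide.1 ha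
    obtain ⟨s, hs, q, hq, rfl⟩ := FusionData.mem_subdivide.1 hb
    rcases eq_or_ne t s with rfl | hts
    · rw [FusionData.tileSupp_vadd, FusionData.tileSupp_vadd]
      exact ((R.comp_isPatch n t.idx).2.2 hp hq fun e => hab (by rw [e])).translate _
    · exact (T.packing ht hs hts).mono (FusionData.tileSupp_subset hp)
        (FusionData.tileSupp_subset hq)
  admitted := by
    intro Q hQ hpatch
    have hpar : ∀ s : Placed (R.J n) d, ∃ t, s ∈ Q →
        t ∈ T.tiles ∧ ∃ p ∈ R.comp n t.idx, t.pos +ᵥ p = s := fun s => by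
      by_cases hs : s ∈ Q
      · obtain ⟨t, ht, h⟩ := FusionData.mem_subdivide.1 (hQ hs)
        exact ⟨t, fun _ => ⟨ht, h⟩⟩
      · obtain ⟨s₀, hs₀, -⟩ := Set.mem_iUnion₂.1 hpatch.2.1.nonempty.some_mem
        obtain ⟨t, -⟩ := FusionData.mem_subdivide.1 (hQ hs₀)
        exact ⟨t, fun h => absurd h hs⟩
    choose par hpar using hpar
    have hsub : par '' Q ⊆ T.tiles := by
      rintro _ ⟨s, hs, rfl⟩
      exact (hpar s hs).1
    obtain ⟨N, j, v, h⟩ := T.admitted (par '' Q) hsub ⟨hpatch.1.image _,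
      isConnected_parents hpatch.2.1
        (fun s hs => by
          obtain ⟨p, hp, e⟩ := (hpar s hs).2
          have := FusionData.tileSupp_subset hp
          rwa [e] at this)
        (fun s _ => (R.nonempty_supp n s.idx).image _)
        (fun s _ => R.isConnected_tileSupp n (par s)), T.packing.mono hsub⟩
    refine ⟨N, j, v, ?_⟩
    rintro _ ⟨s, hs, rfl⟩
    obtain ⟨p, hp, e⟩ := (hpar s hs).2
    have := (h (Set.vadd_mem_vadd_set (mem_image_of_mem par hs))).sub (q := p) hp
    change R.Occurs n N j (v +ᵥ s)
    rw [← e]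
    rwa [← add_vadd]

end Subdivision

section Properties

variable {d : ℕ}

/-- Finite local complexity: up to translation, `T` contains only finitely many connected two-tile
patches. -/
def FusionData.HasFLC (R : FusionData d) (T : Set (Placed (R.J 0) d)) : Prop :=
  ∃ F : Set (Set (Placed (R.J 0) d)), F.Finite ∧
    ∀ Q ⊆ T, R.IsPatch 0 Q → Q.ncard = 2 → ∃ P ∈ F, ∃ v : Space d, Q = v +ᵥ P

/-- For each `n` there is `N > n` such that every `N`-supertile contains every `n`-supertile. -/
def FusionData.IsPrimitive (R : FusionData d) : Prop :=
  ∀ n, ∃ N > n, ∀ (i : Fin (R.J n)) (j : Fin (R.J N)), ∃ v : Space d, R.Occurs n N j ⟨i, v⟩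

/-- Every subdivision map `X^{n+1}_R → X^n_R` is a homeomorphism. -/
def FusionRule.IsRecognizable (R : FusionRule d) : Prop :=
  ∀ n, IsHomeomorph (R.subdivisionMap n)

/-- A van Hove sequence of sets. The closed thickening of a set is `{x | dist(x, A) ≤ r}`. -/
def IsVanHoveSeq (A : ℕ → Set (Space d)) : Prop :=
  ∀ r : ℝ, 0 ≤ r → Tendsto
    (fun n => volume (Metric.cthickening r (frontier (A n))) / volume (A n)) atTop (𝓝 0)

/-- Every choice of one `n`-supertile for each `n` gives a van Hove sequence. -/
def FusionData.IsVanHove (R : FusionData d) : Prop :=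
  ∀ c : ∀ n, Fin (R.J n), IsVanHoveSeq fun n => R.supp n (c n)

/-- The transition matrix `M_{n,n+1}`: its entry `(k, l)` is the number of `n`-supertiles of type
`k` in `P_{n+1}(l)`. -/
def FusionData.transition (R : FusionData d) (n : ℕ) :
    Matrix (Fin (R.J n)) (Fin (R.J (n + 1))) ℝ :=
  fun k l => (((R.comp n l).filter fun p => p.idx = k).card : ℝ)

/-- The transition matrix `M_{n,n+m} = M_{n,n+1} ⋯ M_{n+m-1,n+m}`. -/
def FusionData.transitionTo (R : FusionData d) (n : ℕ) :
    (m : ℕ) → Matrix (Fin (R.J n)) (Fin (R.J (n + m))) ℝ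
  | 0 => (1 : Matrix (Fin (R.J n)) (Fin (R.J n)) ℝ)
  | m + 1 => R.transitionTo n m * R.transition (n + m)

/-- The direction matrix `D_{n,n+m}`, whose columns are the volume-normalized columns
of `M_{n,n+m}`. -/
noncomputable def FusionData.direction (R : FusionData d) (n m : ℕ) :
    Matrix (Fin (R.J n)) (Fin (R.J (n + m))) ℝ :=
  fun i k => R.transitionTo n m i k /
    ∑ l, R.transitionTo n m l k * (volume (R.supp n l)).toReal

/-- There is a vector that all the columns of `D_{n,N}` approach as `N → ∞` (uniformly in the
column, whose number depends on `N`). -/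
def FusionData.AsymptoticallyRankOne (R : FusionData d) (n : ℕ) : Prop :=
  ∃ v : Fin (R.J n) → ℝ, ∀ ε > 0, ∃ m₀, ∀ m ≥ m₀, ∀ k i, |R.direction n m i k - v i| < ε

/-- There is exactly one ergodic invariant Borel probability measure. -/
def UniquelyErgodic (G X : Type*) [VAdd G X] [MeasurableSpace X] : Prop :=
  ∃! μ : Measure X, IsProbabilityMeasure μ ∧ ErgodicVAdd G X μ

end Properties

/-!
The tiling space is compact: by recognizability and primitivity every tiling contains a translate of
every admitted patch, so finite local complexity holds uniformly over all tilings, and chains of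
touching tiles bound the number of patches about a ball (`exists_finite_patchAt`,
`FusionTiling.compactSpace`). On a compact space, unique ergodicity is the same as uniqueness of the
invariant probability measure. This follows from the Krein-Milman theorem, since the extreme points
of the set of invariant measures are ergodic
(`uniquelyErgodic_iff_existsUnique_mem_invariantMeasures`).

By the van Hove property, the limits of averages of continuous functions over larger and larger
supertiles are integrals against invariant measures (`exists_mem_invariantMeasures_tendsto`). So
invariant measures exist, and if there is only one of them, then all these averages converge,
uniformly over the supertiles. For a function built from bump functions inside the `n`-supertiles of
a given type, the integral over `P_N(k)` is exactly the entry of `M_{n,N}` (`setIntegral_detector`).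
So the frequencies `M_{n,N}(i,k) / Vol(P_N(k))` converge, and the columns of `D_{n,N}` are obtained
from them by normalization (`asymptoticallyRankOne_of_tendsto_frequency`).

Conversely, a continuous function depends up to a small error on the patch about the origin, so its
average over a supertile `P_N(k)` is nearly the combination, with the coefficients `D_{n,N}(i,k)`,
of its integrals over the `n`-supertiles. If the matrices are asymptotically rank one, then the
averages over all large supertiles nearly agree (`exists_average_supertiles`). Cutting a much larger region
into such supertiles shows that the averages over translates by the region are nearly constant on
the tiling space (`exists_average_translates`). An invariant measure integrates the function to the
same value as its averages, so there is only one invariant measure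
(`subsingleton_invariantMeasures`).

The boundaries of the prototiles may have positive volume, so the volumes of the pieces of a
supertile need not add up to the volume of the supertile. All counting and cutting is therefore
done with the interiors of supertiles of high levels. These have positive volume, and fill the
supertiles up to a small proportion, by the van Hove property (`eventually_vanHove`).
-/

/-! ### Unique ergodicity and invariant measures -/

section Dynamics

variable {G X : Type*} [AddGroup G] [AddAction G X]

/-- Conditioning an invariant measure on an almost invariant set gives an invariant measure. -/
theorem vaddInvariantMeasure_cond [MeasurableSpace X] {μ : Measure X} [VAddInvariantMeasure G X μ]
    [MeasurableConstVAdd G X] {s : Set X} (hs : MeasurableSet s)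
    (hinv : ∀ g : G, (g +ᵥ ·) ⁻¹' s =ᵐ[μ] s) :
    VAddInvariantMeasure G X (ProbabilityTheory.cond μ s) where
  measure_preimage_vadd g t ht := by
    rw [ProbabilityTheory.cond_apply hs, ProbabilityTheory.cond_apply hs]
    congr 1
    rw [← measure_preimage_vadd_of_nullMeasurableSet (μ := μ)
      ((hs.inter ht).nullMeasurableSet) g, preimage_inter]
    exact measure_congr ((hinv g).symm.inter (ae_eq_refl _))

theorem measure_compl_eq_zero_of_cond_eq [MeasurableSpace X] {μ : Measure X} {s : Set X}
    (hs : MeasurableSet s) (h : ProbabilityTheory.cond μ s = μ) : μ sᶜ = 0 := by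
  rw [← h, ProbabilityTheory.cond_apply hs]
  simp

variable [TopologicalSpace X] [CompactSpace X] [MeasurableSpace X] [BorelSpace X]

/-- A probability measure, seen as the function that integrates the continuous functions. -/
noncomputable def integralFunctional (μ : ProbabilityMeasure X) (f : C(X, ℝ)) : ℝ :=
  ∫ x, f x ∂(μ : Measure X)

theorem integralFunctional_continuous :
    Continuous (integralFunctional : ProbabilityMeasure X → C(X, ℝ) → ℝ) :=
  continuous_pi fun f => ProbabilityMeasure.continuous_integral_continuousMap f

variable [T2Space X] [SecondCountableTopology X]

theorem integralFunctional_injective :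
    Function.Injective (integralFunctional : ProbabilityMeasure X → C(X, ℝ) → ℝ) := by
  intro μ ν h
  refine Subtype.ext ?_
  have : IsProbabilityMeasure μ.1 := μ.2
  have : IsProbabilityMeasure ν.1 := ν.2
  refine ext_of_forall_integral_eq_of_IsFiniteMeasure fun f => ?_
  exact congrFun h f.toContinuousMap

variable (G X) in
/-- The set of invariant Borel probability measures. -/
def invariantMeasures : Set (ProbabilityMeasure X) :=
  {μ | VAddInvariantMeasure G X (μ : Measure X)}

variable [ContinuousConstVAdd G X]

/-- Invariance can be tested on integrals of continuous functions. -/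
theorem mem_invariantMeasures_iff {μ : ProbabilityMeasure X} :
    μ ∈ invariantMeasures G X ↔ ∀ (g : G) (f : C(X, ℝ)),
      integralFunctional μ (f.comp ⟨fun x => g +ᵥ x, continuous_const_vadd g⟩) =
        integralFunctional μ f := by
  have hm : ∀ g : G, Measurable fun x : X => g +ᵥ x :=
    fun g => (continuous_const_vadd g).measurable
  constructor
  · intro h g f
    have h' : VAddInvariantMeasure G X (μ : Measure X) := h
    have hmp : MeasurePreserving (fun x : X => g +ᵥ x) (μ : Measure X) μ :=
      ⟨hm g, Measure.ext fun s hs => by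
        rw [Measure.map_apply (hm g) hs, h'.measure_preimage_vadd g hs]⟩
    exact hmp.integral_comp (Homeomorph.vadd g).measurableEmbedding f
  · intro h
    refine ⟨fun g s hs => ?_⟩
    have : (μ : Measure X).map (fun x => g +ᵥ x) = μ := by
      have := Measure.isProbabilityMeasure_map (μ := (μ : Measure X)) (hm g).aemeasurable
      refine ext_of_forall_integral_eq_of_IsFiniteMeasure fun f => ?_
      rw [integral_map (hm g).aemeasurable f.continuous.aestronglyMeasurable]
      exact h g f.toContinuousMap
    rw [← Measure.map_apply (hm g) hs, this]

theorem isClosed_invariantMeasures : IsClosed (invariantMeasures G X) := by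
  have : invariantMeasures G X = ⋂ (g : G) (f : C(X, ℝ)), {μ |
      integralFunctional μ (f.comp ⟨fun x => g +ᵥ x, continuous_const_vadd g⟩) =
        integralFunctional μ f} := by
    ext μ
    simp only [mem_iInter]
    exact mem_invariantMeasures_iff
  rw [this]
  refine isClosed_iInter fun g => isClosed_iInter fun f => isClosed_eq ?_ ?_
  · exact ProbabilityMeasure.continuous_integral_continuousMap _
  · exact ProbabilityMeasure.continuous_integral_continuousMap f

theorem convex_integralFunctional_image :
    Convex ℝ (integralFunctional '' invariantMeasures G X) := by
  rintro _ ⟨μ, hμ, rfl⟩ _ ⟨ν, hν, rfl⟩ a b ha hb hab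
  let m : Measure X := ENNReal.ofReal a • (μ : Measure X) + ENNReal.ofReal b • (ν : Measure X)
  have hm : IsProbabilityMeasure m := ⟨by simp [m, ← ENNReal.ofReal_add ha hb, hab]⟩
  let ρ : ProbabilityMeasure X := ⟨m, hm⟩
  have key : integralFunctional ρ = a • integralFunctional μ + b • integralFunctional ν := by
    ext f
    change ∫ x, f x ∂m = a * ∫ x, f x ∂(μ : Measure X) + b * ∫ x, f x ∂(ν : Measure X)
    have hi : ∀ ρ : ProbabilityMeasure X, Integrable f (ρ : Measure X) := fun ρ =>
      f.continuous.integrable_of_hasCompactSupport (HasCompactSupport.of_compactSpace f)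
    rw [integral_add_measure ((hi μ).smul_measure ENNReal.ofReal_ne_top)
      ((hi ν).smul_measure ENNReal.ofReal_ne_top), integral_smul_measure, integral_smul_measure]
    simp [ha, hb]
  refine ⟨ρ, ?_, key⟩
  rw [mem_invariantMeasures_iff] at hμ hν ⊢
  intro g f
  simp only [key, Pi.add_apply, Pi.smul_apply, hμ g f, hν g f]

/-- An extreme point of the convex set of invariant probability measures is ergodic: otherwise
it is a proper convex combination of its conditionings on an invariant set and the complement. -/
theorem ergodicVAdd_of_mem_extremePoints {μ : ProbabilityMeasure X}
    (h : integralFunctional μ ∈ (integralFunctional '' invariantMeasures G X).extremePoints ℝ) :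
    ErgodicVAdd G X (μ : Measure X) := by
  have hm : ∀ g : G, Measurable fun x : X => g +ᵥ x :=
    fun g => (continuous_const_vadd g).measurable
  obtain ⟨μ', hμ', e⟩ := h.1
  obtain rfl := integralFunctional_injective e
  have hμ : VAddInvariantMeasure G X (μ' : Measure X) := hμ'
  refine { hμ with aeconst_of_forall_preimage_vadd_ae_eq := fun {s} hs hinv => ?_ }
  rw [eventuallyConst_set]
  by_contra H
  push Not at H
  have h0 : (μ' : Measure X) s ≠ 0 := fun h0 => H.2 (measure_eq_zero_iff_ae_notMem.1 h0)
  have h1 : (μ' : Measure X) sᶜ ≠ 0 := fun h1 => H.1 (by simpa using compl_mem_ae_iff.2 h1)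
  have hinv' : ∀ g : G, (g +ᵥ ·) ⁻¹' sᶜ =ᵐ[(μ' : Measure X)] (sᶜ : Set X) := fun g =>
    (hinv g).compl
  have P := ProbabilityTheory.cond_isProbabilityMeasure h0
  have P' := ProbabilityTheory.cond_isProbabilityMeasure h1
  let ν : ProbabilityMeasure X := ⟨ProbabilityTheory.cond (μ' : Measure X) s, P⟩
  let ν' : ProbabilityMeasure X := ⟨ProbabilityTheory.cond (μ' : Measure X) sᶜ, P'⟩
  have hν : ν ∈ invariantMeasures G X := vaddInvariantMeasure_cond hs hinv
  have hν' : ν' ∈ invariantMeasures G X := vaddInvariantMeasure_cond hs.compl hinv'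
  have hmem : integralFunctional μ' ∈
      openSegment ℝ (integralFunctional ν) (integralFunctional ν') := by
    refine ⟨(μ' : Measure X).real s, (μ' : Measure X).real sᶜ, ?_, ?_, ?_, ?_⟩
    · exact ENNReal.toReal_pos h0 (measure_ne_top _ _)
    · exact ENNReal.toReal_pos h1 (measure_ne_top _ _)
    · rw [measureReal_add_measureReal_compl hs]
      simp
    · ext f
      have hi : Integrable f (μ' : Measure X) :=
        f.continuous.integrable_of_hasCompactSupport (HasCompactSupport.of_compactSpace f)
      have hc : ∀ t : Set X, (μ' : Measure X) t ≠ 0 → (μ' : Measure X).real t *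
          ∫ x, f x ∂(ProbabilityTheory.cond (μ' : Measure X) t) =
          ∫ x in t, f x ∂(μ' : Measure X) := fun t ht => by
        rw [ProbabilityTheory.cond, integral_smul_measure, smul_eq_mul, ← mul_assoc,
          ENNReal.toReal_inv, ← Measure.real, mul_inv_cancel₀, one_mul]
        exact (ENNReal.toReal_pos ht (measure_ne_top _ _)).ne'
      change (μ' : Measure X).real s * ∫ x, f x ∂(ProbabilityTheory.cond (μ' : Measure X) s) +
        (μ' : Measure X).real sᶜ * ∫ x, f x ∂(ProbabilityTheory.cond (μ' : Measure X) sᶜ) =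
        ∫ x, f x ∂(μ' : Measure X)
      rw [hc s h0, hc sᶜ h1, integral_add_compl hs hi]
  have := integralFunctional_injective
    (h.2 (mem_image_of_mem _ hν) (mem_image_of_mem _ hν') hmem)
  exact h1 (measure_compl_eq_zero_of_cond_eq hs (congrArg Subtype.val this))

/-- Unique ergodicity is uniqueness of the invariant probability measure. That there is only one
invariant measure when there is only one ergodic one is the Krein-Milman theorem. -/
theorem uniquelyErgodic_iff_existsUnique_mem_invariantMeasures :
    UniquelyErgodic G X ↔ ∃! μ, μ ∈ invariantMeasures G X := by
  constructor
  · rintro ⟨μ, ⟨hp, he⟩, huniq⟩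
    let S : Set (C(X, ℝ) → ℝ) := integralFunctional '' invariantMeasures G X
    have hS : IsCompact S :=
      isClosed_invariantMeasures.isCompact.image integralFunctional_continuous
    have hμ : (⟨μ, hp⟩ : ProbabilityMeasure X) ∈ invariantMeasures G X :=
      he.toVAddInvariantMeasure
    have hext : S.extremePoints ℝ ⊆ {integralFunctional ⟨μ, hp⟩} := by
      intro Λ hΛ
      obtain ⟨ν, hν, rfl⟩ := hΛ.1
      have := ergodicVAdd_of_mem_extremePoints hΛ
      have e : ν = ⟨μ, hp⟩ := Subtype.ext (huniq _ ⟨ν.2, this⟩)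
      rw [e]
      rfl
    have hsub : S ⊆ {integralFunctional ⟨μ, hp⟩} := by
      rw [← closure_convexHull_extremePoints hS convex_integralFunctional_image]
      refine closure_minimal (convexHull_min hext (convex_singleton _)) isClosed_singleton
    exact ⟨_, hμ, fun ν hν => integralFunctional_injective (hsub (mem_image_of_mem _ hν))⟩
  · rintro ⟨μ, hμ, huniq⟩
    have hm : ∀ g : G, Measurable fun x : X => g +ᵥ x :=
      fun g => (continuous_const_vadd g).measurable
    have hμ' : VAddInvariantMeasure G X (μ : Measure X) := hμ
    refine ⟨μ, ⟨μ.2, { hμ' with aeconst_of_forall_preimage_vadd_ae_eq := fun {s} hs hinv => ?_ }⟩,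
      fun ν hν => ?_⟩
    · rw [eventuallyConst_set]
      by_cases h0 : (μ : Measure X) s = 0
      · exact Or.inr (measure_eq_zero_iff_ae_notMem.1 h0)
      · left
        have P := ProbabilityTheory.cond_isProbabilityMeasure h0
        have := huniq ⟨ProbabilityTheory.cond (μ : Measure X) s, P⟩
          (vaddInvariantMeasure_cond hs hinv)
        exact mem_ae_iff.2 (measure_compl_eq_zero_of_cond_eq hs (congrArg Subtype.val this))
    · exact congrArg Subtype.val (huniq ⟨ν, hν.1⟩ hν.2.toVAddInvariantMeasure)

end Dynamics

/-! ### The uniform structure of a space of tilings -/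

section PatchAt

variable {d : ℕ} {R : FusionData d} {k : ℕ} {S S' : Set (Placed (R.J k) d)}

namespace FusionData

theorem patchAt_eq_of_le {r r' : ℝ} (hr : r ≤ r') (h : R.patchAt k r' S = R.patchAt k r' S') :
    R.patchAt k r S = R.patchAt k r S' := by
  have key : ∀ S : Set (Placed (R.J k) d),
      R.patchAt k r S = R.patchAt k r (R.patchAt k r' S) := fun S => by
    ext t
    refine ⟨fun ht => ⟨⟨ht.1, ht.2.mono ?_⟩, ht.2⟩, fun ht => ⟨ht.1.1, ht.2⟩⟩
    exact inter_subset_inter_right _ (Metric.closedBall_subset_closedBall hr)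
  rw [key, h, ← key]

theorem patchAt_vadd_subset {r : ℝ} (v : Space d) :
    R.patchAt k r (v +ᵥ S) ⊆ v +ᵥ R.patchAt k (r + ‖v‖) S := by
  rintro _ ⟨⟨s, hs, rfl⟩, y, hy, hyr⟩
  refine ⟨s, ⟨hs, ?_⟩, rfl⟩
  change y ∈ R.tileSupp k (v +ᵥ s) at hy
  rw [R.tileSupp_vadd] at hy
  obtain ⟨z, hz, rfl⟩ := hy
  refine ⟨z, hz, ?_⟩
  rw [mem_closedBall_zero_iff] at hyr ⊢
  calc ‖z‖ = ‖(v + z) - v‖ := by rw [add_sub_cancel_left]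
    _ ≤ ‖v + z‖ + ‖v‖ := norm_sub_le _ _
    _ ≤ r + ‖v‖ := by gcongr; exact hyr

theorem patchAt_vadd_eq {r : ℝ} (v : Space d)
    (h : R.patchAt k (r + ‖v‖) S = R.patchAt k (r + ‖v‖) S') :
    R.patchAt k r (v +ᵥ S) = R.patchAt k r (v +ᵥ S') := by
  have key : ∀ {A B : Set (Placed (R.J k) d)},
      R.patchAt k (r + ‖v‖) A = R.patchAt k (r + ‖v‖) B →
      R.patchAt k r (v +ᵥ A) ⊆ R.patchAt k r (v +ᵥ B) := fun {A B} h t ht => by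
    refine ⟨?_, ht.2⟩
    have := patchAt_vadd_subset v ht
    rw [h] at this
    exact vadd_set_mono (fun s hs => hs.1) this
  exact (key h).antisymm (key h.symm)

end FusionData

end PatchAt

namespace FusionTiling

variable {d : ℕ} {R : FusionRule d} {k : ℕ} {T T' T'' : FusionTiling R k} {ε δ : ℝ}

theorem vadd_tiles (v : Space d) (T : FusionTiling R k) : (v +ᵥ T).tiles = v +ᵥ T.tiles := rfl

theorem Close.refl (hε : 0 ≤ ε) (T : FusionTiling R k) : Close ε T T :=
  ⟨0, 0, by simpa, by simpa, rfl⟩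

theorem Close.symm (h : Close ε T T') : Close ε T' T := by
  obtain ⟨g, g', hg, hg', e⟩ := h
  exact ⟨g', g, hg', hg, e.symm⟩

/-- Closeness composes with the loss of a factor two: a translation of length `ε` shrinks the ball
of agreement to radius `1 / ε - ε`, which is at least `1 / (2 * ε)` when `ε ^ 2 ≤ 1 / 2`. -/
theorem Close.trans (hε : 0 < ε) (hε' : ε ^ 2 ≤ 1 / 2) (h : Close ε T T') (h' : Close ε T' T'') :
    Close (2 * ε) T T'' := by
  obtain ⟨a, b, ha, hb, e⟩ := h
  obtain ⟨u, v, hu, hv, e'⟩ := h'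
  have hr : ∀ w : Space d, ‖w‖ ≤ ε → 1 / (2 * ε) + ‖w‖ ≤ 1 / ε := fun w hw => by
    have h1 : ε ≤ 1 / (2 * ε) := by
      rw [le_div_iff₀ (by positivity)]
      nlinarith
    have h2 : 1 / ε = 1 / (2 * ε) + 1 / (2 * ε) := by field_simp; norm_num
    linarith
  refine ⟨u + a, b + v, (norm_add_le _ _).trans (by linarith),
    (norm_add_le _ _).trans (by linarith), ?_⟩
  rw [add_vadd, add_vadd,
    FusionData.patchAt_vadd_eq u (FusionData.patchAt_eq_of_le (hr u hu) e), ← add_vadd,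
    add_comm u b, add_vadd, FusionData.patchAt_vadd_eq b (FusionData.patchAt_eq_of_le (hr b hb) e')]

theorem Close.vadd {x x' : Space d} (h : Close ε T T') (hx : ‖x - x'‖ ≤ ε) (hδ : 2 * ε ≤ δ)
    (hr : 1 / δ + ‖x‖ ≤ 1 / ε) : Close δ (x +ᵥ T) (x' +ᵥ T') := by
  obtain ⟨g, g', hg, hg', e⟩ := h
  have h0 : 0 ≤ ‖x - x'‖ := norm_nonneg _
  refine ⟨g, g' + (x - x'), by linarith, (norm_add_le _ _).trans (by linarith), ?_⟩
  have e1 : g +ᵥ (x +ᵥ T).tiles = x +ᵥ (g +ᵥ T.tiles) := by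
    rw [vadd_tiles, ← add_vadd, ← add_vadd, add_comm]
  have e2 : (g' + (x - x')) +ᵥ (x' +ᵥ T').tiles = x +ᵥ (g' +ᵥ T'.tiles) := by
    rw [vadd_tiles, ← add_vadd, ← add_vadd]
    congr 1
    abel
  rw [e1, e2]
  exact FusionData.patchAt_vadd_eq x (FusionData.patchAt_eq_of_le hr e)

/-- The filter generated by the relations of `ε`-closeness. -/
def closeFilter (R : FusionRule d) (k : ℕ) : Filter (FusionTiling R k × FusionTiling R k) :=
  ⨅ ε ∈ Ioi (0 : ℝ), 𝓟 {p | Close ε p.1 p.2}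

theorem hasBasis_closeFilter : (closeFilter R k).HasBasis (fun ε : ℝ => 0 < ε)
    fun ε => {p | Close ε p.1 p.2} := by
  refine hasBasis_biInf_principal' (fun ε hε δ hδ => ?_) ⟨1, mem_Ioi.2 one_pos⟩
  exact ⟨min ε δ, mem_Ioi.2 (lt_min hε hδ),
    fun p hp => Close.mono (lt_min hε hδ) (min_le_left _ _) hp,
    fun p hp => Close.mono (lt_min hε hδ) (min_le_right _ _) hp⟩

/-- The uniform structure of the big ball metric. -/
instance instUniformSpace : UniformSpace (FusionTiling R k) :=
  .ofCoreEq
    { uniformity := closeFilter R k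
      refl := by
        rw [hasBasis_closeFilter.ge_iff]
        rintro ε hε ⟨T, T'⟩ h
        obtain rfl : T = T' := h
        exact Close.refl (le_of_lt hε) T
      symm := by
        rw [hasBasis_closeFilter.tendsto_iff hasBasis_closeFilter]
        exact fun ε hε => ⟨ε, hε, fun p hp => Close.symm hp⟩
      comp := by
        refine (hasBasis_closeFilter.ge_iff).2 fun ε hε => ?_
        have h0 : 0 < min (ε / 2) (1 / 2) := lt_min (by linarith) (by norm_num)
        refine mem_of_superset (mem_lift' (hasBasis_closeFilter.mem_of_mem h0)) ?_
        rintro ⟨T, T''⟩ ⟨T', h, h'⟩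
        have h1 : min (ε / 2) (1 / 2) ≤ 1 / 2 := min_le_right _ _
        have h2 : min (ε / 2) (1 / 2) ≤ ε / 2 := min_le_left _ _
        exact (Close.trans h0 (by nlinarith) h h').mono (by linarith) (by linarith) }
    instTopologicalSpace <| by
      refine TopologicalSpace.ext_iff.2 fun S => ?_
      change (∀ T ∈ S, ∃ ε > 0, ∀ T', FusionTiling.Close ε T T' → T' ∈ S) ↔
        ∀ T ∈ S, S ∈ comap (Prod.mk T) (closeFilter R k)
      refine forall₂_congr fun T _ => ?_
      rw [(hasBasis_closeFilter.comap (Prod.mk T)).mem_iff]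
      rfl

theorem hasBasis_uniformity : (uniformity (FusionTiling R k)).HasBasis (fun ε : ℝ => 0 < ε)
    fun ε => {p | Close ε p.1 p.2} := hasBasis_closeFilter

theorem hasBasis_nhds (T : FusionTiling R k) :
    (𝓝 T).HasBasis (fun ε : ℝ => 0 < ε) fun ε => {T' | Close ε T T'} :=
  nhds_basis_uniformity' hasBasis_uniformity

instance : (uniformity (FusionTiling R k)).IsCountablyGenerated := by
  have : uniformity (FusionTiling R k) = ⨅ n : ℕ, 𝓟 {p | Close (1 / ((n : ℝ) + 1)) p.1 p.2} := by
    refine le_antisymm (le_iInf fun n => le_principal_iff.2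
      (hasBasis_uniformity.mem_of_mem (by positivity))) ?_
    rw [hasBasis_uniformity.ge_iff]
    intro ε hε
    obtain ⟨n, hn⟩ := exists_nat_one_div_lt hε
    refine mem_iInf_of_mem n (mem_principal.2 fun p hp => ?_)
    exact Close.mono (by positivity) hn.le hp
  rw [this]
  infer_instance

/-- A radius of closeness that serves for translations of length about `r`. -/
theorem exists_close_radius (hδ : 0 < δ) {r : ℝ} (hr : 0 ≤ r) :
    ∃ ε > 0, 2 * ε ≤ δ ∧ 1 / δ + r ≤ 1 / ε := by
  have h : 0 < 2 / δ + r := by positivity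
  refine ⟨1 / (2 / δ + r), by positivity, ?_, ?_⟩
  · rw [mul_one_div, div_le_iff₀ h, mul_add, mul_div_cancel₀ _ hδ.ne']
    nlinarith [mul_nonneg hδ.le hr]
  · rw [one_div_one_div]
    gcongr
    norm_num

instance : ContinuousVAdd (Space d) (FusionTiling R k) where
  continuous_vadd := by
    rw [continuous_iff_continuousAt]
    rintro ⟨x, T⟩
    refine (hasBasis_nhds (x +ᵥ T)).tendsto_right_iff.2 fun δ hδ => ?_
    obtain ⟨ε, hε, h1, h2⟩ := exists_close_radius hδ (norm_nonneg x)
    have hm : {T' | Close ε T T'} ∈ 𝓝 T := (hasBasis_nhds T).mem_of_mem hε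
    filter_upwards [prod_mem_nhds (Metric.closedBall_mem_nhds x hε) hm] with p hp
    refine Close.vadd hp.2 ?_ h1 h2
    rw [← dist_eq_norm, dist_comm]
    exact hp.1

end FusionTiling

/-! ### Iterated decompositions -/

section Geometry

variable {d : ℕ}

theorem NonOverlap.disjoint_interior {A B : Set (Space d)} (h : NonOverlap A B) :
    Disjoint (interior A) B :=
  Set.disjoint_left.2 fun _ hA hB => (h ⟨interior_subset hA, hB⟩).1.2 hA

namespace FusionData

variable (R : FusionData d)

open Classical in
/-- The collection of the `n`-supertiles into which the `(n+m)`-supertile `P_{n+m}(j)` decomposes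
under the chosen fusions. As a `Finset` it forgets multiplicities; these are all one when the
`n`-supertiles have interior points. -/
noncomputable def pieces (n : ℕ) : (m : ℕ) → Fin (R.J (n + m)) → Finset (Placed (R.J n) d)
  | 0, j => {⟨j, 0⟩}
  | m + 1, j => (R.comp (n + m) j).biUnion fun p => (pieces n m p.idx).image (p.pos +ᵥ ·)

variable {R}

theorem mem_pieces_zero {n : ℕ} {j : Fin (R.J n)} {t : Placed (R.J n) d} :
    t ∈ R.pieces n 0 j ↔ t = ⟨j, 0⟩ := Finset.mem_singleton

theorem mem_pieces_succ {n m : ℕ} {j : Fin (R.J (n + m + 1))} {t : Placed (R.J n) d} :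
    t ∈ R.pieces n (m + 1) j ↔
      ∃ p ∈ R.comp (n + m) j, ∃ q ∈ R.pieces n m p.idx, p.pos +ᵥ q = t := by
  classical
  simp [pieces]

theorem Occurs.mem_pieces_cast {n N : ℕ} {j : Fin (R.J N)} {t : Placed (R.J n) d}
    (h : R.Occurs n N j t) : ∃ (m : ℕ) (e : n + m = N), t ∈ R.pieces n m (e ▸ j) := by
  induction h with
  | self j => exact ⟨0, rfl, mem_pieces_zero.2 rfl⟩
  | step j p hp t ht ih =>
    obtain ⟨m, rfl, h⟩ := ih
    exact ⟨m + 1, rfl, mem_pieces_succ.2 ⟨p, hp, t, h, rfl⟩⟩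

theorem occurs_iff_mem_pieces {n m : ℕ} {j : Fin (R.J (n + m))} {t : Placed (R.J n) d} :
    R.Occurs n (n + m) j t ↔ t ∈ R.pieces n m j := by
  constructor
  · intro h
    obtain ⟨m', e, h⟩ := h.mem_pieces_cast
    obtain rfl : m' = m := by omega
    exact h
  · induction m generalizing t with
    | zero =>
      intro h
      rw [mem_pieces_zero.1 h]
      exact Occurs.self j
    | succ m ih =>
      intro h
      obtain ⟨p, hp, q, hq, rfl⟩ := mem_pieces_succ.1 h
      exact Occurs.step j p hp q (ih hq)

theorem tileSupp_zero_pos (n : ℕ) (j : Fin (R.J n)) : R.tileSupp n ⟨j, 0⟩ = R.supp n j :=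
  zero_vadd _ _

theorem tileSupp_eq_biUnion_pieces (n m : ℕ) (s : Placed (R.J (n + m)) d) :
    R.tileSupp (n + m) s = ⋃ t ∈ R.pieces n m s.idx, R.tileSupp n (s.pos +ᵥ t) := by
  induction m with
  | zero =>
    have : R.pieces n 0 s.idx = {⟨s.idx, 0⟩} := rfl
    rw [this]
    simp only [Finset.mem_singleton, iUnion_iUnion_eq_left, tileSupp_vadd, tileSupp_zero_pos]
    rfl
  | succ m ih =>
    refine (R.tileSupp_succ (n + m) s).trans ?_
    ext x
    simp only [mem_iUnion, exists_prop, ih, mem_pieces_succ]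
    constructor
    · rintro ⟨p, hp, q, hq, hx⟩
      refine ⟨p.pos +ᵥ q, ⟨p, hp, q, hq, rfl⟩, ?_⟩
      rw [← add_vadd]
      exact hx
    · rintro ⟨_, ⟨p, hp, q, hq, rfl⟩, hx⟩
      refine ⟨p, hp, q, hq, ?_⟩
      rw [← add_vadd] at hx
      exact hx

theorem supp_eq_biUnion_pieces (n m : ℕ) (j : Fin (R.J (n + m))) :
    R.supp (n + m) j = ⋃ t ∈ R.pieces n m j, R.tileSupp n t := by
  have := R.tileSupp_eq_biUnion_pieces n m ⟨j, 0⟩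
  simpa only [tileSupp_zero_pos, zero_vadd] using this

theorem tileSupp_piece_subset {n m : ℕ} {s : Placed (R.J (n + m)) d} {t : Placed (R.J n) d}
    (ht : t ∈ R.pieces n m s.idx) : R.tileSupp n (s.pos +ᵥ t) ⊆ R.tileSupp (n + m) s := by
  rw [tileSupp_eq_biUnion_pieces]
  exact subset_biUnion_of_mem (u := fun t => R.tileSupp n (s.pos +ᵥ t)) ht

theorem tileSupp_subset_supp {n m : ℕ} {j : Fin (R.J (n + m))} {t : Placed (R.J n) d}
    (ht : t ∈ R.pieces n m j) : R.tileSupp n t ⊆ R.supp (n + m) j := by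
  rw [supp_eq_biUnion_pieces]
  exact subset_biUnion_of_mem (u := fun t => R.tileSupp n t) ht

end FusionData

open FusionData

namespace FusionRule

variable (R : FusionRule d)

theorem isPacking_pieces (n m : ℕ) (j : Fin (R.J (n + m))) :
    R.IsPacking n (R.pieces n m j : Set (Placed (R.J n) d)) := by
  induction m with
  | zero =>
    intro a ha b hb hab
    exact absurd ((mem_pieces_zero.1 ha).trans (mem_pieces_zero.1 hb).symm) hab
  | succ m ih =>
    intro a ha b hb hab
    obtain ⟨p, hp, q, hq, rfl⟩ := mem_pieces_succ.1 ha
    obtain ⟨p', hp', q', hq', rfl⟩ := mem_pieces_succ.1 hb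
    rcases eq_or_ne p p' with rfl | hpp
    · rw [tileSupp_vadd, tileSupp_vadd]
      exact (ih p.idx hq hq' fun e => hab (by rw [e])).translate _
    · exact ((R.comp_isPatch (n + m) j).2.2 hp hp' hpp).mono (tileSupp_piece_subset hq)
        (tileSupp_piece_subset hq')

theorem isCompact_supp : ∀ n j, IsCompact (R.supp n j)
  | 0, j => by
    obtain ⟨h⟩ := R.disk j
    have : CompactSpace (Metric.closedBall (0 : Space d) 1) :=
      isCompact_iff_compactSpace.1 (isCompact_closedBall 0 1)
    exact isCompact_iff_compactSpace.2 h.compactSpace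
  | n + 1, j => (R.comp n j).isCompact_biUnion fun p _ => (isCompact_supp n p.idx).vadd p.pos

theorem isCompact_tileSupp (n : ℕ) (t : Placed (R.J n) d) : IsCompact (R.tileSupp n t) :=
  (R.isCompact_supp n t.idx).vadd t.pos

theorem nonempty_tileSupp (n : ℕ) (t : Placed (R.J n) d) : (R.tileSupp n t).Nonempty :=
  (R.nonempty_supp n t.idx).vadd_set

theorem isConnected_prototile (j : Fin (R.J 0)) : IsConnected (R.prototile j) := by
  obtain ⟨h⟩ := R.disk j
  have : ConnectedSpace (Metric.closedBall (0 : Space d) 1) :=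
    isConnected_iff_connectedSpace.1 ⟨⟨0, Metric.mem_closedBall_self zero_le_one⟩,
      (convex_closedBall 0 1).isPreconnected⟩
  have := h.surjective.connectedSpace h.continuous
  exact isConnected_iff_connectedSpace.2 this

theorem isConnected_tileSupp_zero (t : Placed (R.J 0) d) : IsConnected (R.tileSupp 0 t) :=
  (R.isConnected_prototile t.idx).image _ (continuous_const_vadd t.pos).continuousOn

theorem interior_tileSupp (n : ℕ) (t : Placed (R.J n) d) :
    interior (R.tileSupp n t) = t.pos +ᵥ interior (R.supp n t.idx) :=
  ((Homeomorph.vadd t.pos : Space d ≃ₜ Space d).image_interior _).symm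

/-- A common bound for the sizes of the `n`-supertiles. -/
theorem exists_supp_subset_closedBall (n : ℕ) :
    ∃ D : ℝ, 0 ≤ D ∧ ∀ j, R.supp n j ⊆ Metric.closedBall 0 D := by
  have : Bornology.IsBounded (⋃ j, R.supp n j) :=
    Bornology.isBounded_iUnion.2 fun j => (R.isCompact_supp n j).isBounded
  obtain ⟨D, hD⟩ := this.subset_closedBall 0
  refine ⟨max D 0, le_max_right _ _, fun j => (subset_iUnion _ j).trans (hD.trans ?_)⟩
  exact Metric.closedBall_subset_closedBall (le_max_left _ _)

end FusionRule

/-! ### The hierarchy of supertiles above a tiling -/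

namespace FusionRule

variable (R : FusionRule d)

theorem subdivisionMap_vadd (n : ℕ) (v : Space d) (T : FusionTiling R (n + 1)) :
    R.subdivisionMap n (v +ᵥ T) = v +ᵥ R.subdivisionMap n T := by
  refine FusionTiling.ext (Set.ext fun s => ?_)
  change s ∈ R.subdivide n (v +ᵥ T.tiles) ↔ s ∈ v +ᵥ R.subdivide n T.tiles
  rw [mem_subdivide, mem_vadd_set]
  simp only [mem_subdivide]
  constructor
  · rintro ⟨_, ⟨t, ht, rfl⟩, p, hp, rfl⟩
    exact ⟨_, ⟨t, ht, p, hp, rfl⟩, (add_vadd _ _ _).symm⟩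
  · rintro ⟨_, ⟨t, ht, p, hp, rfl⟩, rfl⟩
    exact ⟨_, ⟨t, ht, rfl⟩, p, hp, add_vadd _ _ _⟩

variable {R} (hrec : R.IsRecognizable)

/-- The way in which a tiling is composed of `n`-supertiles, by recognizability. -/
noncomputable def level (T : FusionTiling R 0) : (n : ℕ) → FusionTiling R n
  | 0 => T
  | n + 1 => ((hrec n).homeomorph _).symm (level T n)

theorem subdivisionMap_level (T : FusionTiling R 0) (n : ℕ) :
    R.subdivisionMap n (level hrec T (n + 1)) = level hrec T n :=
  ((hrec n).homeomorph _).apply_symm_apply _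

theorem continuous_level (n : ℕ) : Continuous fun T => level hrec T n := by
  induction n with
  | zero => exact continuous_id
  | succ n ih => exact ((hrec n).homeomorph _).symm.continuous.comp ih

theorem level_vadd (v : Space d) (T : FusionTiling R 0) (n : ℕ) :
    level hrec (v +ᵥ T) n = v +ᵥ level hrec T n := by
  induction n with
  | zero => rfl
  | succ n ih =>
    apply (hrec n).injective
    rw [subdivisionMap_vadd, subdivisionMap_level, subdivisionMap_level, ih]

theorem mem_level_iff {T : FusionTiling R 0} {n : ℕ} (m : ℕ) {t : Placed (R.J n) d} :
    t ∈ (level hrec T n).tiles ↔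
      ∃ s ∈ (level hrec T (n + m)).tiles, ∃ q ∈ R.pieces n m s.idx, s.pos +ᵥ q = t := by
  induction m with
  | zero =>
    constructor
    · exact fun h => ⟨t, h, ⟨t.idx, 0⟩, mem_pieces_zero.2 rfl, Placed.ext rfl (add_zero _)⟩
    · rintro ⟨s, hs, q, hq, rfl⟩
      rw [mem_pieces_zero.1 hq, show s.pos +ᵥ (⟨s.idx, 0⟩ : Placed (R.J n) d) = s from
        Placed.ext rfl (add_zero _)]
      exact hs
  | succ m ih =>
    rw [ih]
    have key : ∀ s, s ∈ (level hrec T (n + m)).tiles ↔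
        ∃ u ∈ (level hrec T (n + m + 1)).tiles, ∃ p ∈ R.comp (n + m) u.idx, u.pos +ᵥ p = s :=
      fun s => by
        rw [← subdivisionMap_level]
        exact mem_subdivide
    constructor
    · rintro ⟨s, hs, q, hq, rfl⟩
      obtain ⟨u, hu, p, hp, rfl⟩ := (key s).1 hs
      exact ⟨u, hu, p.pos +ᵥ q, mem_pieces_succ.2 ⟨p, hp, q, hq, rfl⟩, (add_vadd _ _ _).symm⟩
    · rintro ⟨u, hu, _, hq', rfl⟩
      obtain ⟨p, hp, q, hq, rfl⟩ := mem_pieces_succ.1 hq'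
      exact ⟨u.pos +ᵥ p, (key _).2 ⟨u, hu, p, hp, rfl⟩, q, hq, add_vadd _ _ _⟩

theorem exists_mem_tiles {n : ℕ} (T : FusionTiling R n) (x : Space d) :
    ∃ t ∈ T.tiles, x ∈ R.tileSupp n t := by
  have : x ∈ ⋃ t ∈ T.tiles, R.tileSupp n t := T.covers ▸ mem_univ x
  simpa using this

end FusionRule

end Geometry

/-! ### Volumes and van Hove estimates -/

section Volume

variable {d : ℕ}

open FusionData

namespace FusionRule

variable {R : FusionRule d}

theorem nonempty_fin (T : FusionTiling R 0) (hrec : R.IsRecognizable) (n : ℕ) :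
    Nonempty (Fin (R.J n)) := by
  obtain ⟨t, -⟩ := exists_mem_tiles (level hrec T n) 0
  exact ⟨t.idx⟩

theorem measurableSet_supp (n : ℕ) (j : Fin (R.J n)) : MeasurableSet (R.supp n j) :=
  (R.isCompact_supp n j).isClosed.measurableSet

theorem volume_supp_ne_top (n : ℕ) (j : Fin (R.J n)) : volume (R.supp n j) ≠ ⊤ :=
  (R.isCompact_supp n j).measure_ne_top

theorem volume_cthickening_ne_top (r : ℝ) (n : ℕ) (j : Fin (R.J n)) :
    volume (Metric.cthickening r (frontier (R.supp n j))) ≠ ⊤ :=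
  ((R.isCompact_supp n j).of_isClosed_subset isClosed_frontier
    (R.isCompact_supp n j).isClosed.frontier_subset).cthickening.measure_ne_top

theorem nonempty_frontier_supp (hd : 0 < d) (n : ℕ) (j : Fin (R.J n)) :
    (frontier (R.supp n j)).Nonempty := by
  have : Nonempty (Fin d) := ⟨⟨0, hd⟩⟩
  rw [nonempty_iff_ne_empty, Ne, ← isClopen_iff_frontier_eq_empty, isClopen_iff]
  rintro (h | h)
  · exact (R.nonempty_supp n j).ne_empty h
  · exact noncompact_univ (Space d) (h ▸ R.isCompact_supp n j)

/-- The van Hove property holds uniformly over the supertiles of a level. In particular the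
supertiles of high levels have positive volume, although nothing is assumed about the volumes of
the prototiles: a set of volume zero has infinite boundary ratio. -/
theorem eventually_vanHove (hd : 0 < d) (hvh : R.IsVanHove) (hJ : ∀ n, Nonempty (Fin (R.J n)))
    (r : ℝ) {ε : ℝ} (hε : 0 < ε) : ∀ᶠ n in atTop, ∀ j, 0 < volume.real (R.supp n j) ∧
      volume.real (Metric.cthickening r (frontier (R.supp n j))) ≤
        ε * volume.real (R.supp n j) := by
  -- The radius is at least one, so that the thickened boundary has positive volume.
  let P : ∀ n, Fin (R.J n) → Prop := fun n j =>
    volume (Metric.cthickening (max r 1) (frontier (R.supp n j))) / volume (R.supp n j) <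
      ENNReal.ofReal ε
  -- The choice of supertiles is the worst one: it violates the bound wherever this is possible.
  have hc : ∀ n, ∃ j, P n j → ∀ j, P n j := fun n => by
    by_cases h : ∀ j, P n j
    · exact ⟨Classical.arbitrary _, fun _ => h⟩
    · push Not at h
      obtain ⟨j, hj⟩ := h
      exact ⟨j, fun h => absurd h hj⟩
  choose c hc using hc
  have h := hvh c (max r 1) (le_max_of_le_right zero_le_one)
  filter_upwards [h.eventually_lt_const (ENNReal.ofReal_pos.2 hε)] with n hn j
  have hj : P n j := hc n hn j
  obtain ⟨x, hx⟩ := nonempty_frontier_supp hd n j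
  have hpos : volume (Metric.cthickening (max r 1) (frontier (R.supp n j))) ≠ 0 := by
    have h1 : Metric.ball x 1 ⊆ Metric.cthickening (max r 1) (frontier (R.supp n j)) :=
      fun y hy => Metric.mem_cthickening_of_dist_le y x _ _ hx
        ((le_of_lt hy).trans (le_max_right _ _))
    exact fun h0 => (Metric.measure_ball_pos volume x one_pos).ne' (measure_mono_null h1 h0)
  have hv : volume (R.supp n j) ≠ 0 := fun h0 => by
    have : P n j := hj
    simp only [P, h0, ENNReal.div_zero hpos] at this
    exact not_top_lt this
  refine ⟨ENNReal.toReal_pos hv (volume_supp_ne_top n j), ?_⟩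
  have h2 : volume (Metric.cthickening r (frontier (R.supp n j))) ≤
      ENNReal.ofReal ε * volume (R.supp n j) := by
    refine (measure_mono (Metric.cthickening_mono (le_max_left r 1) _)).trans ?_
    exact (ENNReal.div_le_iff hv (volume_supp_ne_top n j)).1 (le_of_lt hj)
  have := ENNReal.toReal_mono (ENNReal.mul_ne_top ENNReal.ofReal_ne_top
    (volume_supp_ne_top n j)) h2
  rwa [ENNReal.toReal_mul, ENNReal.toReal_ofReal hε.le] at this

theorem volume_frontier_le_cthickening {r : ℝ} (n : ℕ) (j : Fin (R.J n)) :
    volume.real (frontier (R.supp n j)) ≤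
      volume.real (Metric.cthickening r (frontier (R.supp n j))) :=
  measureReal_mono (Metric.self_subset_cthickening _) (volume_cthickening_ne_top r n j)

theorem volume_supp_eq (n : ℕ) (j : Fin (R.J n)) :
    volume.real (R.supp n j) =
      volume.real (interior (R.supp n j)) + volume.real (frontier (R.supp n j)) := by
  rw [← measureReal_union (disjoint_interior_frontier) isClosed_frontier.measurableSet
    (measure_ne_top_of_subset interior_subset (volume_supp_ne_top n j))
    (measure_ne_top_of_subset (R.isCompact_supp n j).isClosed.frontier_subset
      (volume_supp_ne_top n j)), ← closure_eq_interior_union_frontier,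
    (R.isCompact_supp n j).isClosed.closure_eq]

theorem eventually_volume_interior_pos (hd : 0 < d) (hvh : R.IsVanHove)
    (hJ : ∀ n, Nonempty (Fin (R.J n))) :
    ∀ᶠ n in atTop, ∀ j, 0 < volume.real (interior (R.supp n j)) := by
  filter_upwards [eventually_vanHove hd hvh hJ 0 (half_pos one_pos)] with n hn j
  have h1 := volume_supp_eq n j
  have h2 := volume_frontier_le_cthickening (r := 0) n j
  have h3 := hn j
  linarith

theorem nonempty_interior {n : ℕ} (h : ∀ j, 0 < volume.real (interior (R.supp n j)))
    (t : Placed (R.J n) d) : (interior (R.tileSupp n t)).Nonempty := by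
  rw [interior_tileSupp]
  refine Set.Nonempty.vadd_set (nonempty_iff_ne_empty.2 fun e => ?_)
  have := h t.idx
  simp [e] at this

theorem volume_interior_tileSupp (n : ℕ) (t : Placed (R.J n) d) :
    volume.real (interior (R.tileSupp n t)) = volume.real (interior (R.supp n t.idx)) := by
  rw [interior_tileSupp, Measure.real, Measure.real, measure_vadd]

theorem volume_interior_tileSupp_ne_top (n : ℕ) (t : Placed (R.J n) d) :
    volume (interior (R.tileSupp n t)) ≠ ⊤ :=
  measure_ne_top_of_subset interior_subset (R.isCompact_tileSupp n t).measure_ne_top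

theorem volume_biUnion_interior {n : ℕ} {F : Finset (Placed (R.J n) d)}
    (hF : R.IsPacking n (F : Set (Placed (R.J n) d))) :
    volume.real (⋃ t ∈ F, interior (R.tileSupp n t)) =
      ∑ t ∈ F, volume.real (interior (R.supp n t.idx)) := by
  rw [measureReal_biUnion_finset (fun s hs t ht hst =>
    (hF hs ht hst).disjoint_interior.mono_right interior_subset)
    (fun t _ => isOpen_interior.measurableSet) fun t _ => volume_interior_tileSupp_ne_top n t]
  exact Finset.sum_congr rfl fun t _ => volume_interior_tileSupp n t

/-! ### Local finiteness -/

theorem tileSupp_subset_closedBall {n : ℕ} {D : ℝ}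
    (hD : ∀ j, R.supp n j ⊆ Metric.closedBall 0 D) {t : Placed (R.J n) d} {y : Space d}
    (hy : y ∈ R.tileSupp n t) : R.tileSupp n t ⊆ Metric.closedBall y (2 * D) := by
  obtain ⟨z, hz, rfl⟩ := hy
  rintro _ ⟨w, hw, rfl⟩
  have h1 := mem_closedBall_zero_iff.1 (hD _ hz)
  have h2 := mem_closedBall_zero_iff.1 (hD _ hw)
  rw [Metric.mem_closedBall]
  calc dist (t.pos + w) (t.pos + z) = ‖w - z‖ := by rw [dist_add_left, dist_eq_norm]
    _ ≤ ‖w‖ + ‖z‖ := norm_sub_le _ _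
    _ ≤ 2 * D := by linarith

theorem exists_card_le_of_isPacking {n : ℕ} (h : ∀ j, 0 < volume.real (interior (R.supp n j)))
    (r : ℝ) : ∃ B : ℕ, ∀ F : Finset (Placed (R.J n) d),
      R.IsPacking n (F : Set (Placed (R.J n) d)) →
      (∀ t ∈ F, (R.tileSupp n t ∩ Metric.closedBall 0 r).Nonempty) → F.card ≤ B := by
  obtain ⟨D, hD0, hD⟩ := R.exists_supp_subset_closedBall n
  obtain ⟨c, hc, hcj⟩ : ∃ c > 0, ∀ j, c ≤ volume.real (interior (R.supp n j)) := by
    rcases isEmpty_or_nonempty (Fin (R.J n)) with h' | h'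
    · exact ⟨1, one_pos, fun j => (h'.false j).elim⟩
    · obtain ⟨j, hj⟩ := Finite.exists_min fun j => volume.real (interior (R.supp n j))
      exact ⟨_, h j, hj⟩
  refine ⟨⌈volume.real (Metric.closedBall (0 : Space d) (r + 2 * D)) / c⌉₊, fun F hF hm => ?_⟩
  suffices H : (F.card : ℝ) ≤ volume.real (Metric.closedBall (0 : Space d) (r + 2 * D)) / c by
    exact_mod_cast H.trans (Nat.le_ceil _)
  rw [le_div_iff₀ hc]
  calc (F.card : ℝ) * c = ∑ _t ∈ F, c := by simp
    _ ≤ ∑ t ∈ F, volume.real (interior (R.supp n t.idx)) := Finset.sum_le_sum fun t _ => hcj _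
    _ = volume.real (⋃ t ∈ F, interior (R.tileSupp n t)) := (volume_biUnion_interior hF).symm
    _ ≤ _ := by
      refine measureReal_mono (iUnion₂_subset fun t ht => interior_subset.trans ?_)
        (isCompact_closedBall _ _).measure_ne_top
      obtain ⟨y, hy, hyr⟩ := hm t ht
      refine (tileSupp_subset_closedBall hD hy).trans (Metric.closedBall_subset_closedBall' ?_)
      rw [Metric.mem_closedBall] at hyr
      linarith

/-- A bound, uniform over all tilings, for the number of tiles that meet a ball. It comes from the
supertiles of a high level, whose interiors have positive volume. -/
theorem exists_card_le (hd : 0 < d) (hvh : R.IsVanHove) (hrec : R.IsRecognizable) (r : ℝ) :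
    ∃ B : ℕ, ∀ (T : FusionTiling R 0) (F : Finset (Placed (R.J 0) d)),
      (F : Set (Placed (R.J 0) d)) ⊆ R.patchAt 0 r T.tiles → F.card ≤ B := by
  classical
  rcases isEmpty_or_nonempty (FusionTiling R 0) with h0 | ⟨⟨T₀⟩⟩
  · exact ⟨0, fun T => (h0.false T).elim⟩
  obtain ⟨m, hm⟩ := eventually_atTop.1
    (eventually_volume_interior_pos hd hvh (nonempty_fin T₀ hrec))
  obtain ⟨B, hB⟩ := exists_card_le_of_isPacking (hm (0 + m) (by omega)) r
  obtain ⟨C, hC⟩ : ∃ C, ∀ j, (R.pieces 0 m j).card ≤ C :=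
    ⟨∑ j, (R.pieces 0 m j).card, fun j =>
      Finset.single_le_sum (f := fun j => (R.pieces 0 m j).card) (fun _ _ => Nat.zero_le _)
        (Finset.mem_univ j)⟩
  refine ⟨B * C, fun T F hF => ?_⟩
  have hpar : ∀ t, ∃ s, t ∈ F → s ∈ R.patchAt (0 + m) r (level hrec T (0 + m)).tiles ∧
      ∃ q ∈ R.pieces 0 m s.idx, s.pos +ᵥ q = t := fun t => by
    by_cases ht : t ∈ F
    · obtain ⟨s, hs, q, hq, e⟩ := (mem_level_iff hrec m).1 (hF ht).1
      refine ⟨s, fun _ => ⟨⟨hs, (hF ht).2.mono (inter_subset_inter_left _ ?_)⟩, q, hq, e⟩⟩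
      rw [← e]
      exact tileSupp_piece_subset hq
    · exact ⟨⟨Classical.choice (nonempty_fin T₀ hrec _), 0⟩, fun h => absurd h ht⟩
  choose par hpar using hpar
  have hsub : F ⊆ (F.image par).biUnion fun s => (R.pieces 0 m s.idx).image (s.pos +ᵥ ·) := by
    intro t ht
    obtain ⟨-, q, hq, e⟩ := hpar t ht
    exact Finset.mem_biUnion.2 ⟨_, Finset.mem_image_of_mem par ht, Finset.mem_image.2 ⟨q, hq, e⟩⟩
  have hcard : (F.image par).card ≤ B := by
    refine hB _ ((level hrec T (0 + m)).packing.mono fun s hs => ?_) fun s hs => ?_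
    · obtain ⟨t, ht, rfl⟩ := Finset.mem_image.1 hs
      exact (hpar t ht).1.1
    · obtain ⟨t, ht, rfl⟩ := Finset.mem_image.1 hs
      exact (hpar t ht).1.2
  calc F.card ≤ _ := Finset.card_le_card hsub
    _ ≤ (F.image par).card * C :=
      Finset.card_biUnion_le_card_mul _ _ _ fun s _ => Finset.card_image_le.trans (hC _)
    _ ≤ B * C := Nat.mul_le_mul_right _ hcard

theorem finite_of_forall_card_le {α : Type*} {Q : Set α} {B : ℕ}
    (h : ∀ F : Finset α, (F : Set α) ⊆ Q → F.card ≤ B) :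
    Q.Finite := by
  by_contra hinf
  obtain ⟨F, hF, e⟩ := Set.Infinite.exists_subset_card_eq hinf (B + 1)
  have := h F hF
  omega

theorem finite_patchAt (hd : 0 < d) (hvh : R.IsVanHove) (hrec : R.IsRecognizable)
    (T : FusionTiling R 0) (r : ℝ) : (R.patchAt 0 r T.tiles).Finite := by
  obtain ⟨B, hB⟩ := exists_card_le hd hvh hrec r
  exact finite_of_forall_card_le (hB T)

/-! ### Transition matrices count pieces -/

theorem sum_comp (n : ℕ) (k : Fin (R.J (n + 1))) (g : Fin (R.J n) → ℝ) :
    ∑ p ∈ R.comp n k, g p.idx = ∑ j, R.transition n j k * g j := by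
  rw [← Finset.sum_fiberwise (R.comp n k) (fun p => p.idx)]
  refine Finset.sum_congr rfl fun j _ => ?_
  rw [Finset.sum_congr rfl fun p hp => by rw [(Finset.mem_filter.1 hp).2], Finset.sum_const,
    nsmul_eq_mul]
  rfl

theorem sum_transitionTo_succ (n m : ℕ) (k : Fin (R.J (n + (m + 1)))) (g : Fin (R.J n) → ℝ) :
    ∑ i, R.transitionTo n (m + 1) i k * g i =
      ∑ p ∈ R.comp (n + m) k, ∑ i, R.transitionTo n m i p.idx * g i := by
  rw [sum_comp (n + m) k fun j => ∑ i, R.transitionTo n m i j * g i]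
  simp only [transitionTo, Matrix.mul_apply, Finset.sum_mul, Finset.mul_sum]
  rw [Finset.sum_comm]
  exact Finset.sum_congr rfl fun j _ => Finset.sum_congr rfl fun i _ => by ring

/-- The transition matrix `M_{n,n+m}` counts the pieces of the `(n+m)`-supertiles. That no piece
is counted twice uses that `n`-supertiles have interior points. -/
theorem sum_pieces {n : ℕ} (h : ∀ j, 0 < volume.real (interior (R.supp n j))) (m : ℕ)
    (k : Fin (R.J (n + m))) (g : Fin (R.J n) → ℝ) :
    ∑ t ∈ R.pieces n m k, g t.idx = ∑ i, R.transitionTo n m i k * g i := by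
  classical
  induction m with
  | zero =>
    have : R.pieces n 0 k = {⟨k, 0⟩} := rfl
    rw [this, Finset.sum_singleton]
    change g k = ∑ i, (1 : Matrix (Fin (R.J n)) (Fin (R.J n)) ℝ) i k * g i
    simp [Matrix.one_apply]
  | succ m ih =>
    rw [sum_transitionTo_succ, pieces, Finset.sum_biUnion]
    · refine Finset.sum_congr rfl fun p _ => ?_
      rw [Finset.sum_image fun a _ b _ e => vadd_left_cancel p.pos e]
      exact ih p.idx
    · intro p hp p' hp' hpp
      refine Finset.disjoint_left.2 fun t ht ht' => ?_
      obtain ⟨q, hq, rfl⟩ := Finset.mem_image.1 ht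
      obtain ⟨q', hq', e⟩ := Finset.mem_image.1 ht'
      have h1 := tileSupp_piece_subset hq
      have h2 := tileSupp_piece_subset hq'
      change p'.pos +ᵥ q' = p.pos +ᵥ q at e
      rw [e] at h2
      obtain ⟨x, hx⟩ := nonempty_interior h (p.pos +ᵥ q)
      exact Set.disjoint_left.1 ((R.comp_isPatch (n + m) k).2.2 hp hp' hpp).disjoint_interior
        (interior_mono h1 hx) (h2 (interior_subset hx))

theorem transitionTo_nonneg (n m : ℕ) (i : Fin (R.J n)) (k : Fin (R.J (n + m))) :
    0 ≤ R.transitionTo n m i k := by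
  induction m with
  | zero =>
    change 0 ≤ (1 : Matrix (Fin (R.J n)) (Fin (R.J n)) ℝ) i k
    rw [Matrix.one_apply]
    split_ifs <;> norm_num
  | succ m ih =>
    simp only [transitionTo, Matrix.mul_apply]
    exact Finset.sum_nonneg fun j _ => mul_nonneg (ih j) (Nat.cast_nonneg _)

theorem volume_supp_le_sum (n m : ℕ) (k : Fin (R.J (n + m))) :
    volume.real (R.supp (n + m) k) ≤
      ∑ i, R.transitionTo n m i k * volume.real (R.supp n i) := by
  induction m with
  | zero =>
    change _ ≤ ∑ i, (1 : Matrix (Fin (R.J n)) (Fin (R.J n)) ℝ) i k * volume.real (R.supp n i)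
    simp [Matrix.one_apply]
  | succ m ih =>
    rw [sum_transitionTo_succ]
    refine (measureReal_biUnion_finset_le _ _).trans (Finset.sum_le_sum fun p _ => ?_)
    rw [Measure.real, measure_vadd]
    exact ih p.idx

end FusionRule

end Volume

/-! ### Finite local complexity, uniformly over all tilings -/

section Compactness

variable {d : ℕ}

open FusionData

namespace FusionRule

variable {R : FusionRule d}

theorem exists_mem_level_idx (hprim : R.IsPrimitive) (hrec : R.IsRecognizable)
    (T : FusionTiling R 0) (N : ℕ) (j : Fin (R.J N)) :
    ∃ s ∈ (level hrec T N).tiles, s.idx = j := by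
  obtain ⟨N', hN', h⟩ := hprim N
  obtain ⟨m, rfl⟩ := Nat.exists_eq_add_of_le hN'.le
  obtain ⟨u, hu, -⟩ := exists_mem_tiles (level hrec T (N + m)) 0
  obtain ⟨v, hv⟩ := h j u.idx
  exact ⟨_, (mem_level_iff hrec m).2 ⟨u, hu, _, occurs_iff_mem_pieces.1 hv, rfl⟩, rfl⟩

/-- Every admitted patch occurs in every tiling. -/
theorem exists_vadd_subset_of_admitted (hprim : R.IsPrimitive) (hrec : R.IsRecognizable)
    (T : FusionTiling R 0) {Q : Set (Placed (R.J 0) d)} (hQ : R.Admitted 0 Q) :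
    ∃ v : Space d, v +ᵥ Q ⊆ T.tiles := by
  obtain ⟨N, j, v, h⟩ := hQ
  obtain ⟨m, rfl⟩ : ∃ m, N = 0 + m := ⟨N, by omega⟩
  obtain ⟨s, hs, rfl⟩ := exists_mem_level_idx hprim hrec T (0 + m) j
  refine ⟨s.pos + v, ?_⟩
  rw [add_vadd]
  rintro _ ⟨t, ht, rfl⟩
  exact (mem_level_iff hrec m (n := 0)).2 ⟨s, hs, t, occurs_iff_mem_pieces.1 (h ht), rfl⟩

/-- The relative positions of two tiles that touch take only finitely many values. -/
theorem exists_finite_touching (hflc : ∀ T : FusionTiling R 0, R.HasFLC T.tiles)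
    (hprim : R.IsPrimitive) (hrec : R.IsRecognizable) :
    ∃ V : Set (Space d), V.Finite ∧ ∀ T : FusionTiling R 0, ∀ s ∈ T.tiles, ∀ t ∈ T.tiles,
      (R.tileSupp 0 s ∩ R.tileSupp 0 t).Nonempty → t.pos - s.pos ∈ V := by
  rcases isEmpty_or_nonempty (FusionTiling R 0) with h0 | ⟨⟨T₀⟩⟩
  · exact ⟨∅, finite_empty, fun T => (h0.false T).elim⟩
  obtain ⟨F, hF, H⟩ := hflc T₀
  refine ⟨insert 0 (⋃ P ∈ {P ∈ F | P.Finite}, image2 (fun s t => t.pos - s.pos) P P), ?_, ?_⟩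
  · exact ((hF.subset (sep_subset _ _)).biUnion fun P hP => hP.2.image2 _ hP.2).insert 0
  · intro T s hs t ht hst
    rcases eq_or_ne s t with rfl | hne
    · exact Or.inl (sub_self _)
    right
    have hsub : ({s, t} : Set (Placed (R.J 0) d)) ⊆ T.tiles := by
      rintro _ (rfl | rfl)
      exacts [hs, ht]
    have hpatch : R.IsPatch 0 {s, t} := by
      refine ⟨(finite_singleton t).insert s, ?_, T.packing.mono hsub⟩
      rw [biUnion_pair]
      exact (R.isConnected_tileSupp_zero s).union hst (R.isConnected_tileSupp_zero t)
    obtain ⟨v, hv⟩ := exists_vadd_subset_of_admitted hprim hrec T₀ (T.admitted _ hsub hpatch)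
    obtain ⟨P, hP, w, hw⟩ := H _ hv (hpatch.vadd _ v) (by
      rw [← image_vadd, ncard_image_of_injective _ (AddAction.injective v), ncard_pair hne])
    have hmem : ∀ u ∈ ({s, t} : Set (Placed (R.J 0) d)), ∃ a ∈ P, w +ᵥ a = v +ᵥ u := fun u hu => by
      have : v +ᵥ u ∈ v +ᵥ ({s, t} : Set (Placed (R.J 0) d)) := vadd_mem_vadd_set hu
      rwa [hw] at this
    have hPfin : P.Finite := by
      have : (w +ᵥ P).Finite := hw ▸ (hpatch.vadd _ v).1
      exact this.of_finite_image (AddAction.injective w).injOn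
    obtain ⟨a, ha, ea⟩ := hmem s (Or.inl rfl)
    obtain ⟨b, hb, eb⟩ := hmem t (Or.inr rfl)
    refine mem_biUnion (show P ∈ {P ∈ F | P.Finite} from ⟨hP, hPfin⟩) ⟨a, ha, b, hb, ?_⟩
    have ea' : w + a.pos = v + s.pos := congrArg Placed.pos ea
    have eb' : w + b.pos = v + t.pos := congrArg Placed.pos eb
    calc b.pos - a.pos = (w + b.pos) - (w + a.pos) := by abel
      _ = t.pos - s.pos := by rw [ea', eb']; abel

theorem isPreconnected_patchAt (T : FusionTiling R 0) {r : ℝ} (hr : 0 ≤ r) :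
    IsPreconnected (⋃ t ∈ R.patchAt 0 r T.tiles, R.tileSupp 0 t) := by
  have hball : Metric.closedBall 0 r ⊆ ⋃ t ∈ R.patchAt 0 r T.tiles, R.tileSupp 0 t := fun x hx => by
    obtain ⟨t, ht, hxt⟩ := exists_mem_tiles T x
    exact mem_biUnion (show t ∈ R.patchAt 0 r T.tiles from ⟨ht, x, hxt, hx⟩) hxt
  refine isPreconnected_of_forall 0 fun y hy => ?_
  obtain ⟨t, ht, hy⟩ := mem_iUnion₂.1 hy
  refine ⟨Metric.closedBall 0 r ∪ R.tileSupp 0 t, union_subset hball ?_,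
    Or.inl (Metric.mem_closedBall_self hr), Or.inr hy, ?_⟩
  · exact subset_biUnion_of_mem (u := fun t => R.tileSupp 0 t) ht
  · obtain ⟨z, hz, hzr⟩ := ht.2
    exact (convex_closedBall 0 r).isPreconnected.union z hzr hz
      (R.isConnected_tileSupp_zero t).isPreconnected

/-- In a locally finite tiling, any two tiles that meet a ball are joined by a chain of touching
tiles that meet the ball. -/
theorem reachable_patchAt (T : FusionTiling R 0) {r : ℝ} (hr : 0 ≤ r)
    (hfin : (R.patchAt 0 r T.tiles).Finite) (s t : R.patchAt 0 r T.tiles) :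
    (SimpleGraph.fromRel fun a b : R.patchAt 0 r T.tiles =>
      (R.tileSupp 0 a.1 ∩ R.tileSupp 0 b.1).Nonempty).Reachable s t := by
  set G := SimpleGraph.fromRel fun a b : R.patchAt 0 r T.tiles =>
    (R.tileSupp 0 a.1 ∩ R.tileSupp 0 b.1).Nonempty
  have : Finite (R.patchAt 0 r T.tiles) := hfin
  by_contra hst
  let A : Set (Space d) := ⋃ a ∈ {a | G.Reachable s a}, R.tileSupp 0 a.1
  let B : Set (Space d) := ⋃ a ∈ {a | ¬ G.Reachable s a}, R.tileSupp 0 a.1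
  have hA : IsClosed A := (toFinite _).isClosed_biUnion fun a _ =>
    (R.isCompact_tileSupp 0 a.1).isClosed
  have hB : IsClosed B := (toFinite _).isClosed_biUnion fun a _ =>
    (R.isCompact_tileSupp 0 a.1).isClosed
  have hsubA : ∀ a : R.patchAt 0 r T.tiles, G.Reachable s a → R.tileSupp 0 a.1 ⊆ A := fun a ha =>
    subset_biUnion_of_mem (u := fun a : R.patchAt 0 r T.tiles => R.tileSupp 0 a.1) ha
  have hsubB : ∀ a : R.patchAt 0 r T.tiles, ¬ G.Reachable s a → R.tileSupp 0 a.1 ⊆ B := fun a ha =>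
    subset_biUnion_of_mem (u := fun a : R.patchAt 0 r T.tiles => R.tileSupp 0 a.1) ha
  have hU : ∀ a : R.patchAt 0 r T.tiles,
      R.tileSupp 0 a.1 ⊆ ⋃ t ∈ R.patchAt 0 r T.tiles, R.tileSupp 0 t := fun a =>
    subset_biUnion_of_mem (u := fun t => R.tileSupp 0 t) a.2
  obtain ⟨x, hx⟩ := R.nonempty_tileSupp 0 s.1
  obtain ⟨y, hy⟩ := R.nonempty_tileSupp 0 t.1
  obtain ⟨z, -, hzA, hzB⟩ := isPreconnected_closed_iff.1 (isPreconnected_patchAt T hr) A B hA hB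
    (iUnion₂_subset fun a ha => by
      by_cases h : G.Reachable s ⟨a, ha⟩
      · exact (hsubA _ h).trans subset_union_left
      · exact (hsubB _ h).trans subset_union_right)
    ⟨x, hU s hx, hsubA s (SimpleGraph.Reachable.refl s) hx⟩ ⟨y, hU t hy, hsubB t hst hy⟩
  obtain ⟨a, ha, hza⟩ := mem_iUnion₂.1 hzA
  obtain ⟨b, hb, hzb⟩ := mem_iUnion₂.1 hzB
  refine hb (SimpleGraph.Reachable.trans ha (SimpleGraph.Adj.reachable ?_))
  refine (SimpleGraph.fromRel_adj _ _ _).2 ⟨?_, Or.inl ⟨z, hza, hzb⟩⟩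
  rintro rfl
  exact hb ha

/-- The relative positions of two tiles that meet a given ball take only finitely many values, for
all tilings together. -/
theorem exists_finite_patchAt (hd : 0 < d) (hflc : ∀ T : FusionTiling R 0, R.HasFLC T.tiles)
    (hprim : R.IsPrimitive) (hvh : R.IsVanHove) (hrec : R.IsRecognizable) {r : ℝ} (hr : 0 ≤ r) :
    ∃ W : Set (Space d), W.Finite ∧ ∀ T : FusionTiling R 0, ∀ s ∈ R.patchAt 0 r T.tiles,
      ∀ t ∈ R.patchAt 0 r T.tiles, t.pos - s.pos ∈ W := by
  obtain ⟨V, hV, H⟩ := exists_finite_touching hflc hprim hrec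
  obtain ⟨B, hB⟩ := exists_card_le hd hvh hrec r
  have hnV : ∀ n : ℕ, (n • V).Finite := fun n => by
    induction n with
    | zero => simp
    | succ n ih => rw [succ_nsmul]; exact ih.add hV
  refine ⟨⋃ n ∈ Finset.range B, n • V,
    (Finset.range B).finite_toSet.biUnion fun n _ => hnV n, fun T s hs t ht => ?_⟩
  have hfin : (R.patchAt 0 r T.tiles).Finite := finite_of_forall_card_le (hB T)
  have : Fintype (R.patchAt 0 r T.tiles) := hfin.fintype
  -- A path in the finite graph of touching tiles has fewer than `B` steps, each of them in `V`.
  obtain ⟨w, hw⟩ := (reachable_patchAt T hr hfin ⟨s, hs⟩ ⟨t, ht⟩).exists_isPath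
  have hlen : w.length < B := hw.length_lt.trans_le (by
    have := hB T hfin.toFinset (by simp)
    rwa [Finite.card_toFinset] at this)
  refine mem_biUnion (Finset.mem_coe.2 (Finset.mem_range.2 hlen)) ?_
  have key : ∀ {a b : R.patchAt 0 r T.tiles} (w : (SimpleGraph.fromRel
      fun a b : R.patchAt 0 r T.tiles =>
        (R.tileSupp 0 a.1 ∩ R.tileSupp 0 b.1).Nonempty).Walk a b),
      b.1.pos - a.1.pos ∈ w.length • V := fun w => by
    induction w with
    | nil => simp
    | @cons a b c hab w ih =>
      rw [SimpleGraph.Walk.length_cons, succ_nsmul]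
      refine ⟨_, ih, b.1.pos - a.1.pos, H T a.1 a.2.1 b.1 b.2.1 ?_, by simp⟩
      rcases ((SimpleGraph.fromRel_adj _ _ _).1 hab).2 with h | h
      · exact h
      · rwa [inter_comm]
  exact key w

end FusionRule

/-! ### Compactness of the tiling space -/

namespace FusionTiling

open FusionRule

variable {R : FusionRule d}

/-- Tilings that are `ε`-close for all `ε` are equal, since the tilings are locally finite. -/
theorem t2Space (hd : 0 < d) (hvh : R.IsVanHove) (hrec : R.IsRecognizable) :
    T2Space (FusionTiling R 0) := by
  have key : ∀ T T' : FusionTiling R 0, (∀ ε > 0, Close ε T T') → T.tiles ⊆ T'.tiles := by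
    intro T T' h t ht
    obtain ⟨y, hy⟩ := R.nonempty_tileSupp 0 t
    let S : Set (Space d) := Placed.pos '' {u ∈ R.patchAt 0 (‖y‖ + 2) T'.tiles | u.idx = t.idx}
    have hS : IsClosed S :=
      (((finite_patchAt hd hvh hrec T' (‖y‖ + 2)).subset (sep_subset _ _)).image _).isClosed
    have hmem : t.pos ∈ S := by
      rw [← hS.closure_eq, Metric.mem_closure_iff]
      intro η hη
      obtain ⟨ε, hε, hε1, hεη, hεr⟩ : ∃ ε > 0, ε ≤ 1 ∧ 2 * ε < η ∧ ‖y‖ + 1 ≤ 1 / ε := by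
        refine ⟨min (η / 3) (1 / (‖y‖ + 1)), by positivity, ?_, ?_, ?_⟩
        · refine (min_le_right _ _).trans ?_
          rw [div_le_one (by positivity)]
          linarith [norm_nonneg y]
        · have := min_le_left (η / 3) (1 / (‖y‖ + 1))
          linarith
        · rw [le_one_div (by positivity) (by positivity)]
          exact min_le_right _ _
      obtain ⟨g, g', hg, hg', e⟩ := h ε hε
      have hgt : g +ᵥ t ∈ R.patchAt 0 (1 / ε) (g +ᵥ T.tiles) := by
        refine ⟨vadd_mem_vadd_set ht, g + y, ?_, ?_⟩
        · rw [tileSupp_vadd]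
          exact vadd_mem_vadd_set hy
        · rw [mem_closedBall_zero_iff]
          linarith [norm_add_le g y]
      rw [e] at hgt
      obtain ⟨u, hu, eu⟩ := hgt.1
      have eu' : g' +ᵥ u = g +ᵥ t := eu
      have eu1 : u.idx = t.idx := (Placed.ext_iff.1 eu').1
      have eu2 : g' + u.pos = g + t.pos := (Placed.ext_iff.1 eu').2
      have eu3 : u.pos - t.pos = g - g' := by
        rw [sub_eq_sub_iff_add_eq_add, add_comm, eu2]
      have eu4 : u = (u.pos - t.pos) +ᵥ t := Placed.ext eu1 (sub_add_cancel _ _).symm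
      have hn : ‖u.pos - t.pos‖ ≤ 2 * ε := by
        rw [eu3]
        linarith [norm_sub_le g g']
      refine ⟨u.pos, ⟨u, ⟨⟨hu, (u.pos - t.pos) + y, ?_, ?_⟩, eu1⟩, rfl⟩, ?_⟩
      · have : R.tileSupp 0 u = (u.pos - t.pos) +ᵥ R.tileSupp 0 t := by
          conv_lhs => rw [eu4, tileSupp_vadd]
        rw [this]
        exact vadd_mem_vadd_set hy
      · rw [mem_closedBall_zero_iff]
        linarith [norm_add_le (u.pos - t.pos) y]
      · rw [dist_comm, dist_eq_norm]
        linarith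
    obtain ⟨u, ⟨hu, hi⟩, hp⟩ := hmem
    rw [← Placed.ext hi hp]
    exact hu.1
  have : T0Space (FusionTiling R 0) := by
    rw [t0Space_iff_uniformity]
    intro T T' h
    have hc : ∀ ε > 0, Close ε T T' := fun ε hε => h _ (hasBasis_uniformity.mem_of_mem hε)
    exact FusionTiling.ext ((key T T' hc).antisymm (key T' T fun ε hε => (hc ε hε).symm))
  infer_instance

/-- Finite local complexity makes the tiling space compact. The tilings of an ultrafilter,
translated so that a chosen tile sits at the origin, have eventually constant patches about the
origin, and these fit together to a tiling. -/
theorem compactSpace (hd : 0 < d) (hflc : ∀ T : FusionTiling R 0, R.HasFLC T.tiles)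
    (hprim : R.IsPrimitive) (hvh : R.IsVanHove) (hrec : R.IsRecognizable) :
    CompactSpace (FusionTiling R 0) := by
  refine ⟨isCompact_iff_ultrafilter_le_nhds.2 fun 𝒰 _ => ?_⟩
  have hex : ∀ T : FusionTiling R 0, ∃ t ∈ T.tiles, (0 : Space d) ∈ R.tileSupp 0 t :=
    fun T => exists_mem_tiles T 0
  choose t₀ ht₀ h0t₀ using hex
  obtain ⟨D, hD0, hD⟩ := R.exists_supp_subset_closedBall 0
  have hpos : ∀ T, ‖(t₀ T).pos‖ ≤ D := fun T => by
    obtain ⟨z, hz, e⟩ := h0t₀ T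
    have e' : (t₀ T).pos + z = 0 := e
    rw [eq_neg_of_add_eq_zero_left e', norm_neg]
    exact mem_closedBall_zero_iff.1 (hD _ hz)
  obtain ⟨p, -, hp⟩ := isCompact_iff_ultrafilter_le_nhds.1 (isCompact_closedBall (0 : Space d) D)
    (𝒰.map fun T => (t₀ T).pos) (le_principal_iff.2
      (Ultrafilter.mem_map.2 (univ_mem' fun T => mem_closedBall_zero_iff.2 (hpos T))))
  have hp' : Tendsto (fun T => (t₀ T).pos) 𝒰 (𝓝 p) := hp
  -- The tiles that eventually occur at a fixed position relative to the chosen tile.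
  let L : Set (Placed (R.J 0) d) := {t | ∀ᶠ T in (𝒰 : Filter (FusionTiling R 0)),
    (t₀ T).pos +ᵥ t ∈ T.tiles}
  have hL : ∀ r : ℝ, 0 ≤ r → ∀ᶠ T in (𝒰 : Filter (FusionTiling R 0)),
      R.patchAt 0 r (-(t₀ T).pos +ᵥ T.tiles) = R.patchAt 0 r L := by
    intro r hr
    obtain ⟨W, hW, H⟩ := exists_finite_patchAt hd hflc hprim hvh hrec (add_nonneg hr hD0)
    let C : Set (Placed (R.J 0) d) := {t | t.pos ∈ W}
    have hC : C.Finite := by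
      refine ((finite_univ (α := Fin (R.J 0))).image2 (fun i v => ⟨i, v⟩) hW).subset fun t ht => ?_
      exact ⟨t.idx, mem_univ _, t.pos, ht, rfl⟩
    have hmemC : ∀ (T : FusionTiling R 0) (t : Placed (R.J 0) d), (t₀ T).pos +ᵥ t ∈ T.tiles →
        (R.tileSupp 0 t ∩ Metric.closedBall 0 r).Nonempty → t ∈ C := by
      rintro T t ht ⟨y, hy, hyr⟩
      have h1 : (t₀ T).pos +ᵥ t ∈ R.patchAt 0 (r + D) T.tiles := by
        refine ⟨ht, (t₀ T).pos + y, ?_, ?_⟩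
        · rw [tileSupp_vadd]
          exact vadd_mem_vadd_set hy
        · rw [mem_closedBall_zero_iff] at hyr ⊢
          linarith [norm_add_le (t₀ T).pos y, hpos T]
      have h2 : t₀ T ∈ R.patchAt 0 (r + D) T.tiles :=
        ⟨ht₀ T, 0, h0t₀ T, Metric.mem_closedBall_self (add_nonneg hr hD0)⟩
      have h3 : ((t₀ T).pos + t.pos) - (t₀ T).pos ∈ W := H T _ h2 _ h1
      rwa [add_sub_cancel_left] at h3
    have hiff : ∀ᶠ T in (𝒰 : Filter (FusionTiling R 0)), ∀ t ∈ C,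
        ((t₀ T).pos +ᵥ t ∈ T.tiles ↔ t ∈ L) := by
      refine (eventually_all_finite hC).2 fun t _ => ?_
      by_cases ht : t ∈ L
      · have ht' : ∀ᶠ T in (𝒰 : Filter (FusionTiling R 0)), (t₀ T).pos +ᵥ t ∈ T.tiles := ht
        filter_upwards [ht'] with T hT
        exact iff_of_true hT ht
      · have ht' : ∀ᶠ T in (𝒰 : Filter (FusionTiling R 0)), ¬ (t₀ T).pos +ᵥ t ∈ T.tiles :=
          Ultrafilter.eventually_not.2 ht
        filter_upwards [ht'] with T hT
        exact iff_of_false hT ht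
    filter_upwards [hiff] with T hT
    ext t
    have hmem : t ∈ -(t₀ T).pos +ᵥ T.tiles ↔ (t₀ T).pos +ᵥ t ∈ T.tiles := by
      rw [mem_vadd_set_iff_neg_vadd_mem, neg_neg]
    constructor
    · rintro ⟨ht, hr⟩
      exact ⟨(hT t (hmemC T t (hmem.1 ht) hr)).1 (hmem.1 ht), hr⟩
    · rintro ⟨ht, hr⟩
      have ht' : ∀ᶠ T in (𝒰 : Filter (FusionTiling R 0)), (t₀ T).pos +ᵥ t ∈ T.tiles := ht
      obtain ⟨T', hT'⟩ := ht'.exists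
      exact ⟨hmem.2 ((hT t (hmemC T' t hT' hr)).2 ht), hr⟩
  have hlim : ∃ S : FusionTiling R 0, S.tiles = L := by
    refine ⟨⟨L, ?_, ?_, ?_⟩, rfl⟩
    · refine eq_univ_of_forall fun x => ?_
      obtain ⟨T, hT⟩ := (hL ‖x‖ (norm_nonneg x)).exists
      obtain ⟨t, ht, hx⟩ := exists_mem_tiles (-(t₀ T).pos +ᵥ T) x
      have : t ∈ R.patchAt 0 ‖x‖ (-(t₀ T).pos +ᵥ T.tiles) :=
        ⟨ht, x, hx, mem_closedBall_zero_iff.2 le_rfl⟩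
      rw [hT] at this
      exact mem_biUnion this.1 hx
    · intro s hs t ht hst
      have hs' : ∀ᶠ T in (𝒰 : Filter (FusionTiling R 0)), (t₀ T).pos +ᵥ s ∈ T.tiles := hs
      have ht' : ∀ᶠ T in (𝒰 : Filter (FusionTiling R 0)), (t₀ T).pos +ᵥ t ∈ T.tiles := ht
      obtain ⟨T, h1, h2⟩ := (hs'.and ht').exists
      have := (T.packing h1 h2 fun e => hst (vadd_left_cancel _ e)).translate (-(t₀ T).pos)
      rwa [← tileSupp_vadd, ← tileSupp_vadd, neg_vadd_vadd, neg_vadd_vadd] at this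
    · intro Q hQ hpatch
      obtain ⟨T, hT⟩ := ((eventually_all_finite hpatch.1).2 fun t ht => hQ ht).exists
      refine Admitted.of_vadd _ (v := (t₀ T).pos) (T.admitted _ ?_ (hpatch.vadd _ _))
      rintro _ ⟨t, ht, rfl⟩
      exact hT t ht
  obtain ⟨S, hS⟩ := hlim
  refine ⟨p +ᵥ S, mem_univ _, (hasBasis_nhds (p +ᵥ S)).ge_iff.2 fun δ hδ => ?_⟩
  filter_upwards [hL (1 / δ + ‖p‖) (by positivity),
    hp'.eventually (Metric.closedBall_mem_nhds p hδ)] with T hT hTp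
  refine ⟨0, p - (t₀ T).pos, by simpa using hδ.le, ?_, ?_⟩
  · rwa [dist_comm, dist_eq_norm] at hTp
  · rw [zero_vadd, vadd_tiles, sub_eq_add_neg, add_vadd, hS]
    exact (patchAt_vadd_eq p hT).symm

theorem secondCountableTopology [CompactSpace (FusionTiling R 0)] :
    SecondCountableTopology (FusionTiling R 0) := by
  let _ := UniformSpace.pseudoMetricSpace (FusionTiling R 0)
  infer_instance

end FusionTiling

end Compactness

/-! ### Averages of a function over supertiles -/

section Averages

variable {d : ℕ}

theorem exists_mem_frontier_of_mem_of_notMem {E : Set (Space d)} {x y : Space d} (hx : x ∈ E)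
    (hy : y ∉ E) : ∃ z ∈ frontier E, dist z x ≤ dist x y ∧ dist z y ≤ dist x y := by
  by_contra! H
  have hseg : ∀ z ∈ segment ℝ x y, z ∉ frontier E := fun z hz hzE =>
    absurd (Metric.mem_closedBall.1 (segment_subset_closedBall_right x y hz))
      (not_le.2 (H z hzE (Metric.mem_closedBall.1 (segment_subset_closedBall_left x y hz))))
  have hin : ∀ z ∈ segment ℝ x y, z ∈ closure E → z ∈ interior E := fun z hz h => by
    by_contra hi
    exact hseg z hz ⟨h, hi⟩
  obtain ⟨z, -, hz1, hz2⟩ := (convex_segment (𝕜 := ℝ) x y).isPreconnected (interior E) (closure E)ᶜ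
    isOpen_interior isClosed_closure.isOpen_compl
    (fun z hz => by
      by_cases h : z ∈ closure E
      · exact Or.inl (hin z hz h)
      · exact Or.inr h)
    ⟨x, left_mem_segment ℝ x y, hin x (left_mem_segment ℝ x y) (subset_closure hx)⟩
    ⟨y, right_mem_segment ℝ x y, fun h =>
      hy (interior_subset (hin y (right_mem_segment ℝ x y) h))⟩
  exact hz2 (subset_closure (interior_subset hz1))

theorem mem_cthickening_frontier {E : Set (Space d)} {x y : Space d} {r : ℝ} (hx : x ∈ E)
    (hy : y ∉ E) (hr : dist x y ≤ r) :
    x ∈ Metric.cthickening r (frontier E) ∧ y ∈ Metric.cthickening r (frontier E) := by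
  obtain ⟨z, hz, h1, h2⟩ := exists_mem_frontier_of_mem_of_notMem hx hy
  rw [dist_comm] at h1 h2
  exact ⟨Metric.mem_cthickening_of_dist_le x z _ _ hz (h1.trans hr),
    Metric.mem_cthickening_of_dist_le y z _ _ hz (h2.trans hr)⟩

theorem abs_setIntegral_translate_sub_le {E : Set (Space d)} (hE : IsCompact E)
    {h : Space d → ℝ} (hc : Continuous h) {C : ℝ} (hC : ∀ x, |h x| ≤ C) (v : Space d) :
    |(∫ x in E, h (x - v)) - ∫ x in E, h x| ≤
      C * volume.real (Metric.cthickening ‖v‖ (frontier E)) := by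
  have hth : IsCompact (Metric.cthickening ‖v‖ (frontier E)) :=
    (hE.of_isClosed_subset isClosed_frontier hE.isClosed.frontier_subset).cthickening
  let a : Space d → ℝ := E.indicator fun x => h (x - v)
  have ha : Integrable a := (integrable_indicator_iff hE.measurableSet).2
    ((hc.comp (continuous_id.sub continuous_const)).continuousOn.integrableOn_compact hE)
  have hb : Integrable (E.indicator h) := (integrable_indicator_iff hE.measurableSet).2
    (hc.continuousOn.integrableOn_compact hE)
  have hg : Integrable ((Metric.cthickening ‖v‖ (frontier E)).indicator fun _ => C) :=
    (integrable_indicator_iff hth.measurableSet).2 (continuousOn_const.integrableOn_compact hth)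
  have e1 : ∫ x in E, h (x - v) = ∫ y, a (y + v) := by
    rw [integral_add_right_eq_self a v]
    exact (integral_indicator hE.measurableSet).symm
  rw [e1, ← integral_indicator (f := h) hE.measurableSet,
    ← integral_sub (f := fun y => a (y + v)) (ha.comp_add_right v) hb, ← Real.norm_eq_abs]
  have hC0 : 0 ≤ C := (abs_nonneg _).trans (hC 0)
  refine (norm_integral_le_of_norm_le (g := (Metric.cthickening ‖v‖ (frontier E)).indicator
    fun _ => C) hg (Eventually.of_forall fun y => ?_)).trans_eq ?_
  · by_cases h1 : y + v ∈ E <;> by_cases h2 : y ∈ E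
    · simp only [a, indicator_of_mem h1, indicator_of_mem h2, add_sub_cancel_right, sub_self,
        norm_zero]
      exact indicator_nonneg (fun _ _ => hC0) y
    · have := (mem_cthickening_frontier (r := ‖v‖) h1 h2 (by simp [dist_eq_norm])).2
      simp only [a, indicator_of_mem h1, indicator_of_notMem h2, indicator_of_mem this,
        add_sub_cancel_right, sub_zero]
      exact hC y
    · have := (mem_cthickening_frontier (r := ‖v‖) h2 h1 (by simp [dist_eq_norm])).1
      simp only [a, indicator_of_notMem h1, indicator_of_mem h2, indicator_of_mem this,
        zero_sub, norm_neg]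
      exact hC y
    · simp only [a, indicator_of_notMem h1, indicator_of_notMem h2, sub_self, norm_zero]
      exact indicator_nonneg (fun _ _ => hC0) y
  · rw [integral_indicator hth.measurableSet, setIntegral_const, smul_eq_mul, mul_comm]

theorem setIntegral_vadd_set (p : Space d) (A : Set (Space d)) (h : Space d → ℝ) :
    ∫ x in p +ᵥ A, h x = ∫ x in A, h (p + x) := by
  rw [← (measurePreserving_add_left volume p).setIntegral_preimage_emb
    (measurableEmbedding_addLeft p)]
  congr 2
  ext x
  exact vadd_mem_vadd_set_iff (a := p) (x := x) (s := A)

open FusionData FusionRule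

variable {R : FusionRule d}

theorem integrableOn_of_abs_le {E : Set (Space d)} (hE : volume E ≠ ⊤) {h : Space d → ℝ}
    (hc : Continuous h) {C : ℝ} (hC : ∀ x, |h x| ≤ C) : IntegrableOn h E :=
  Measure.integrableOn_of_bounded hE hc.aestronglyMeasurable (M := C)
    (Eventually.of_forall hC)

/-- Cutting the integral over a set into integrals over the interiors of supertiles costs at most
the volume that these interiors leave over. -/
theorem abs_setIntegral_sub_sum_le {n : ℕ} {F : Finset (Placed (R.J n) d)}
    (hF : R.IsPacking n (F : Set (Placed (R.J n) d))) {E : Set (Space d)}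
    (hEfin : volume E ≠ ⊤) (hFE : ∀ t ∈ F, interior (R.tileSupp n t) ⊆ E) {h : Space d → ℝ}
    (hc : Continuous h) {C : ℝ} (hC : ∀ x, |h x| ≤ C) :
    |(∫ x in E, h x) - ∑ t ∈ F, ∫ x in interior (R.tileSupp n t), h x| ≤
      C * (volume.real E - ∑ t ∈ F, volume.real (interior (R.supp n t.idx))) := by
  have hU : MeasurableSet (⋃ t ∈ F, interior (R.tileSupp n t)) :=
    F.measurableSet_biUnion fun t _ => isOpen_interior.measurableSet
  have hUE : (⋃ t ∈ F, interior (R.tileSupp n t)) ⊆ E := iUnion₂_subset hFE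
  rw [← integral_biUnion_finset F (fun t _ => isOpen_interior.measurableSet)
    (fun s hs t ht hst => (hF hs ht hst).disjoint_interior.mono_right interior_subset)
    (fun t _ => integrableOn_of_abs_le (volume_interior_tileSupp_ne_top n t) hc hC),
    ← setIntegral_sdiff hU (integrableOn_of_abs_le hEfin hc hC) hUE, ← volume_biUnion_interior hF,
    ← measureReal_sdiff hUE hU hEfin, ← Real.norm_eq_abs]
  exact norm_setIntegral_le_of_norm_le_const
    (measure_ne_top_of_subset sdiff_subset hEfin).lt_top fun x _ => hC x

namespace FusionTiling

/-- The values of a function along the orbit of a tiling. The sign is such that the integral over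
the support of a supertile of `S` is an integral over translates of `S` that carry this supertile
to the origin. -/
def orbit (f : C(FusionTiling R 0, ℝ)) (S : FusionTiling R 0) (x : Space d) : ℝ := f (-x +ᵥ S)

theorem continuous_orbit (f : C(FusionTiling R 0, ℝ)) (S : FusionTiling R 0) :
    Continuous (orbit f S) :=
  f.continuous.comp (continuous_neg.vadd continuous_const)

theorem orbit_add (f : C(FusionTiling R 0, ℝ)) (S : FusionTiling R 0) (p x : Space d) :
    orbit f S (p + x) = orbit f (-p +ᵥ S) x := by
  rw [orbit, orbit, ← add_vadd]
  congr 2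
  abel

/-- A continuous function on a compact tiling space depends, up to `ε`, only on the patch about
the origin. -/
theorem exists_radius [CompactSpace (FusionTiling R 0)] (f : C(FusionTiling R 0, ℝ)) {ε : ℝ}
    (hε : 0 < ε) : ∃ r, ∀ T T' : FusionTiling R 0,
      R.patchAt 0 r T.tiles = R.patchAt 0 r T'.tiles → |f T - f T'| ≤ ε := by
  have hu := CompactSpace.uniformContinuous_of_continuous f.continuous
  obtain ⟨δ, hδ, H⟩ := (hasBasis_uniformity.uniformContinuous_iff Metric.uniformity_basis_dist_le).1
    hu ε hε
  refine ⟨1 / δ, fun T T' h => H T T' ⟨0, 0, by simpa using hδ.le,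
    by simpa using hδ.le, ?_⟩⟩
  rwa [zero_vadd, zero_vadd]

end FusionTiling

open FusionTiling

theorem FusionRule.exists_base (hprim : R.IsPrimitive) (hrec : R.IsRecognizable)
    (T : FusionTiling R 0) (n : ℕ) (k : Fin (R.J n)) :
    ∃ S : FusionTiling R 0, (⟨k, 0⟩ : Placed (R.J n) d) ∈ (level hrec S n).tiles := by
  obtain ⟨s, hs, rfl⟩ := exists_mem_level_idx hprim hrec T n k
  refine ⟨-s.pos +ᵥ T, ?_⟩
  rw [level_vadd]
  exact ⟨s, hs, Placed.ext rfl (neg_add_cancel _)⟩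

/-- Two tilings with the same supertile at the origin agree in its interior. -/
theorem FusionRule.patchAt_subset_of_mem_level (hrec : R.IsRecognizable) {n : ℕ}
    {s : Placed (R.J n) d} {S T : FusionTiling R 0} (hS : s ∈ (level hrec S n).tiles)
    (hT : s ∈ (level hrec T n).tiles) {x : Space d} {r : ℝ}
    (hx : Metric.closedBall x r ⊆ interior (R.tileSupp n s)) :
    R.patchAt 0 r (-x +ᵥ T.tiles) ⊆ R.patchAt 0 r (-x +ᵥ S.tiles) := by
  obtain ⟨m, rfl⟩ : ∃ m, n = 0 + m := ⟨n, by omega⟩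
  rintro _ ⟨⟨t, ht, rfl⟩, hne⟩
  refine ⟨vadd_mem_vadd_set ?_, hne⟩
  obtain ⟨y, hy, hyr⟩ := hne
  change y ∈ R.tileSupp 0 (-x +ᵥ t) at hy
  rw [tileSupp_vadd] at hy
  obtain ⟨z, hz, rfl⟩ := hy
  have hzx : z ∈ Metric.closedBall x r := by
    rw [mem_closedBall_zero_iff] at hyr
    rw [Metric.mem_closedBall, dist_eq_norm]
    calc ‖z - x‖ = ‖-x + z‖ := by rw [neg_add_eq_sub]
      _ ≤ r := hyr
  obtain ⟨s', hs', q, hq, rfl⟩ := (mem_level_iff hrec m (n := 0)).1 ht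
  have : s' = s := by
    by_contra hne
    exact Set.disjoint_left.1
      ((level hrec T (0 + m)).packing hT hs' (Ne.symm hne)).disjoint_interior (hx hzx) (tileSupp_piece_subset hq hz)
  subst this
  exact (mem_level_iff hrec m (n := 0)).2 ⟨_, hS, q, hq, rfl⟩

/-- The integral of a function over a supertile of a tiling is nearly determined by the type of the
supertile. -/
theorem FusionRule.abs_setIntegral_orbit_sub_le (hrec : R.IsRecognizable)
    {f : C(FusionTiling R 0, ℝ)} {C ε r : ℝ} (hC : ∀ T, |f T| ≤ C) (hε : 0 ≤ ε)
    (hmod : ∀ T T' : FusionTiling R 0,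
      R.patchAt 0 r T.tiles = R.patchAt 0 r T'.tiles → |f T - f T'| ≤ ε)
    {n : ℕ} {S T : FusionTiling R 0} {s : Placed (R.J n) d}
    (hS : (⟨s.idx, 0⟩ : Placed (R.J n) d) ∈ (level hrec S n).tiles)
    (hT : s ∈ (level hrec T n).tiles) :
    |(∫ x in interior (R.tileSupp n s), orbit f T x) -
        ∫ x in interior (R.supp n s.idx), orbit f S x| ≤
      ε * volume.real (R.supp n s.idx) +
        2 * C * volume.real (Metric.cthickening r (frontier (R.supp n s.idx))) := by
  rw [interior_tileSupp, setIntegral_vadd_set]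
  simp only [orbit_add]
  set T' := -s.pos +ᵥ T
  have hT' : (⟨s.idx, 0⟩ : Placed (R.J n) d) ∈ (level hrec T' n).tiles := by
    rw [level_vadd]
    exact ⟨s, hT, Placed.ext rfl (neg_add_cancel _)⟩
  set E := R.supp n s.idx
  have hEfin : volume E ≠ ⊤ := volume_supp_ne_top n s.idx
  have hIfin : volume (interior E) ≠ ⊤ := measure_ne_top_of_subset interior_subset hEfin
  set K := Metric.cthickening r (frontier E)
  have hKfin : volume K ≠ ⊤ := volume_cthickening_ne_top r n s.idx
  have hKm : MeasurableSet K := Metric.isClosed_cthickening.measurableSet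
  have hC0 : 0 ≤ C := (abs_nonneg _).trans (hC S)
  have hi : ∀ U : FusionTiling R 0, IntegrableOn (orbit f U) (interior E) := fun U =>
    integrableOn_of_abs_le hIfin (continuous_orbit f U) fun x => hC _
  rw [← integral_sub (hi T') (hi S)]
  have hpt : ∀ x ∈ interior E,
      ‖orbit f T' x - orbit f S x‖ ≤ ε + K.indicator (fun _ => 2 * C) x := by
    intro x hx
    by_cases hxK : x ∈ K
    · rw [indicator_of_mem hxK]
      refine (norm_sub_le _ _).trans ?_
      have h1 : ‖orbit f T' x‖ ≤ C := hC _
      have h2 : ‖orbit f S x‖ ≤ C := hC _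
      linarith
    · rw [indicator_of_notMem hxK, add_zero]
      have hball : Metric.closedBall x r ⊆ interior (R.tileSupp n ⟨s.idx, 0⟩) := by
        rw [tileSupp_zero_pos]
        intro y hy
        have hyE : y ∈ E := by
          by_contra hyE
          exact hxK (mem_cthickening_frontier (interior_subset hx) hyE
            (by rw [dist_comm]; exact hy)).1
        by_contra hyi
        exact hxK (Metric.mem_cthickening_of_dist_le x y _ _ ⟨subset_closure hyE, hyi⟩
          (by rw [dist_comm]; exact hy))
      exact hmod _ _ ((patchAt_subset_of_mem_level hrec hS hT' hball).antisymm
        (patchAt_subset_of_mem_level hrec hT' hS hball))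
  have hindi : Integrable (K.indicator fun _ => 2 * C) (volume.restrict (interior E)) :=
    ((integrable_indicator_iff hKm).2 (integrableOn_const hKfin)).restrict
  have hci : Integrable (fun _ => ε) (volume.restrict (interior E)) := integrableOn_const hIfin
  refine (norm_integral_le_of_norm_le (hci.add hindi)
    ((ae_restrict_iff' isOpen_interior.measurableSet).2 (Eventually.of_forall hpt))).trans ?_
  simp only [Pi.add_apply]
  rw [integral_add hci hindi, integral_indicator hKm, Measure.restrict_restrict hKm,
    setIntegral_const, setIntegral_const, smul_eq_mul, smul_eq_mul, mul_comm, mul_comm _ (2 * C)]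
  gcongr
  · exact interior_subset
  · exact inter_subset_left

end Averages

/-! ### Rank one direction matrices give uniform averages -/

section RankOne

variable {d : ℕ} {R : FusionRule d}

open FusionData FusionRule FusionTiling

namespace FusionRule

theorem volume_interior_le (n : ℕ) (i : Fin (R.J n)) :
    volume.real (interior (R.supp n i)) ≤ volume.real (R.supp n i) :=
  measureReal_mono interior_subset (volume_supp_ne_top n i)

/-- The integral over a region that is nearly filled by `n`-supertiles of a tiling is nearly the sum
of the standard integrals `b i` over `n`-supertiles. Here `ε` bounds the boundary ratios of the
`n`-supertiles, and `κ` the volume that is not covered. -/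
theorem abs_setIntegral_orbit_sub_sum_le (hrec : R.IsRecognizable)
    {f : C(FusionTiling R 0, ℝ)} {C ε r κ : ℝ} (hC : ∀ T, |f T| ≤ C) (hε : 0 ≤ ε) (hε' : ε ≤ 1 / 2)
    (hmod : ∀ T T' : FusionTiling R 0,
      R.patchAt 0 r T.tiles = R.patchAt 0 r T'.tiles → |f T - f T'| ≤ ε)
    {n : ℕ} (hth : ∀ i, volume.real (Metric.cthickening r (frontier (R.supp n i))) ≤
      ε * volume.real (R.supp n i))
    {S : Fin (R.J n) → FusionTiling R 0}
    (hS : ∀ i, (⟨i, 0⟩ : Placed (R.J n) d) ∈ (level hrec (S i) n).tiles)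
    {T : FusionTiling R 0} {F : Finset (Placed (R.J n) d)}
    (hF : (F : Set (Placed (R.J n) d)) ⊆ (level hrec T n).tiles) {E : Set (Space d)}
    (hE : volume E ≠ ⊤) (hFE : ∀ s ∈ F, interior (R.tileSupp n s) ⊆ E)
    (hκ : volume.real E ≤ (∑ s ∈ F, volume.real (R.supp n s.idx)) + κ) :
    |(∫ x in E, orbit f T x) -
        ∑ s ∈ F, ∫ x in interior (R.supp n s.idx), orbit f (S s.idx) x| ≤
      (2 + 6 * C) * ε * volume.real E + C * κ ∧
    volume.real E - ∑ s ∈ F, volume.real (interior (R.supp n s.idx)) ≤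
      2 * ε * volume.real E + κ ∧
    ∑ s ∈ F, volume.real (interior (R.supp n s.idx)) ≤ volume.real E := by
  have hC0 : 0 ≤ C := (abs_nonneg _).trans (hC T)
  have hpack := (level hrec T n).packing.mono hF
  have hVW : ∀ i, volume.real (R.supp n i) - volume.real (interior (R.supp n i)) ≤
      ε * volume.real (R.supp n i) := fun i => by
    have h1 := volume_supp_eq n i
    have h2 := volume_frontier_le_cthickening (r := r) n i
    linarith [hth i]
  have hV0 : ∀ i, 0 ≤ volume.real (R.supp n i) := fun i => measureReal_nonneg
  set V := ∑ s ∈ F, volume.real (R.supp n s.idx)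
  set W := ∑ s ∈ F, volume.real (interior (R.supp n s.idx))
  have hWE : W ≤ volume.real E := by
    exact (volume_biUnion_interior hpack).ge.trans (measureReal_mono (iUnion₂_subset hFE) hE)
  have hsum : V - W ≤ ε * V := by
    rw [← Finset.sum_sub_distrib, Finset.mul_sum]
    exact Finset.sum_le_sum fun s _ => hVW _
  have hV : 0 ≤ V := Finset.sum_nonneg fun s _ => hV0 _
  have hVE : V ≤ 2 * volume.real E := by nlinarith
  have hEW : volume.real E - W ≤ 2 * ε * volume.real E + κ := by nlinarith
  refine ⟨?_, hEW, hWE⟩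
  have h1 := abs_setIntegral_sub_sum_le hpack hE hFE (continuous_orbit f T) fun x => hC _
  have h2 : |(∑ s ∈ F, ∫ x in interior (R.tileSupp n s), orbit f T x) -
      ∑ s ∈ F, ∫ x in interior (R.supp n s.idx), orbit f (S s.idx) x| ≤
      (ε + 2 * C * ε) * V := by
    rw [← Finset.sum_sub_distrib, Finset.mul_sum]
    refine (Finset.abs_sum_le_sum_abs _ _).trans (Finset.sum_le_sum fun s hs => ?_)
    refine (abs_setIntegral_orbit_sub_le hrec hC hε hmod (hS s.idx) (hF hs)).trans ?_
    have := mul_le_mul_of_nonneg_left (hth s.idx) (mul_nonneg zero_le_two hC0)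
    linarith
  refine (abs_sub_le _ _ _).trans ((add_le_add h1 h2).trans ?_)
  have h3 := mul_le_mul_of_nonneg_left hEW hC0
  have h4 : (ε + 2 * C * ε) * V ≤ (ε + 2 * C * ε) * (2 * volume.real E) :=
    mul_le_mul_of_nonneg_left hVE (by positivity)
  nlinarith

theorem abs_setIntegral_interior_le {f : C(FusionTiling R 0, ℝ)} {C : ℝ} (hC : ∀ T, |f T| ≤ C)
    (n : ℕ) (i : Fin (R.J n)) (S : FusionTiling R 0) :
    |∫ x in interior (R.supp n i), orbit f S x| ≤ C * volume.real (interior (R.supp n i)) := by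
  rw [← Real.norm_eq_abs]
  exact norm_setIntegral_le_of_norm_le_const
    (measure_ne_top_of_subset interior_subset (volume_supp_ne_top n i)).lt_top fun _ _ => hC _

/-- If the direction matrices are asymptotically rank one, then the averages of a continuous
function over the supertiles of a high level nearly agree. -/
theorem exists_average_supertiles [CompactSpace (FusionTiling R 0)] (hd : 0 < d)
    (hvh : R.IsVanHove) (hrec : R.IsRecognizable) (hone : ∀ n, R.AsymptoticallyRankOne n)
    {f : C(FusionTiling R 0, ℝ)} {C : ℝ} (hC : ∀ T, |f T| ≤ C)
    {S : ∀ n, Fin (R.J n) → FusionTiling R 0}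
    (hS : ∀ n i, (⟨i, 0⟩ : Placed (R.J n) d) ∈ (level hrec (S n i) n).tiles)
    (hJ : ∀ n, Nonempty (Fin (R.J n))) {ε : ℝ} (hε : 0 < ε) :
    ∃ β, |β| ≤ C + 1 ∧ ∀ᶠ N in atTop, ∀ k,
      |(∫ x in interior (R.supp N k), orbit f (S N k) x) -
        β * volume.real (interior (R.supp N k))| ≤
      ε * volume.real (interior (R.supp N k)) := by
  have hC0 : 0 ≤ C := by
    obtain ⟨i⟩ := hJ 0
    exact (abs_nonneg _).trans (hC (S 0 i))
  -- The errors made below add up to `(6 + 8 * C) * η` times the volume.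
  obtain ⟨η, hη, hη1, hη2⟩ : ∃ η > 0, η ≤ 1 / 2 ∧ (6 + 8 * C) * η ≤ ε := by
    refine ⟨min (1 / 2) (ε / (6 + 8 * C)), by positivity, min_le_left _ _, ?_⟩
    refine (mul_le_mul_of_nonneg_left (min_le_right _ _) (by positivity)).trans_eq ?_
    field_simp
  obtain ⟨r, hmod⟩ := exists_radius f hη
  obtain ⟨n, hn⟩ := (eventually_vanHove hd hvh hJ r hη).exists
  let b : Fin (R.J n) → ℝ := fun i => ∫ x in interior (R.supp n i), orbit f (S n i) x
  let Wn : Fin (R.J n) → ℝ := fun i => volume.real (interior (R.supp n i))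
  let Vn : Fin (R.J n) → ℝ := fun i => volume.real (R.supp n i)
  have hW : ∀ i, 0 < volume.real (interior (R.supp n i)) := fun i => by
    have h1 := volume_supp_eq n i
    have h2 := volume_frontier_le_cthickening (r := r) n i
    have h3 := hn i
    nlinarith
  obtain ⟨v, hv⟩ := hone n
  obtain ⟨m₀, hm₀⟩ := hv (η / (∑ i, |b i| + 1)) (by positivity)
  have hD : ∀ m ≥ m₀, ∀ k, |∑ i, R.direction n m i k * b i - ∑ i, v i * b i| ≤ η := by
    intro m hm k
    rw [← Finset.sum_sub_distrib]
    calc |∑ i, (R.direction n m i k * b i - v i * b i)|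
        ≤ ∑ i, |R.direction n m i k * b i - v i * b i| := Finset.abs_sum_le_sum_abs _ _
      _ ≤ ∑ i, η / (∑ i, |b i| + 1) * |b i| := Finset.sum_le_sum fun i _ => by
        rw [← sub_mul, abs_mul]
        exact mul_le_mul_of_nonneg_right (hm₀ m hm k i).le (abs_nonneg _)
      _ = η / (∑ i, |b i| + 1) * ∑ i, |b i| := (Finset.mul_sum _ _ _).symm
      _ ≤ η := by
        have : 0 ≤ ∑ i, |b i| := Finset.sum_nonneg fun i _ => abs_nonneg _
        rw [div_mul_eq_mul_div, div_le_iff₀ (by positivity)]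
        nlinarith
  -- Here `s` is the total volume of the pieces, the denominator in the direction matrix.
  have hmain : ∀ m k, 0 < volume.real (R.supp (n + m) k) → ∃ s : ℝ, 0 < s ∧
      s * ∑ i, R.direction n m i k * b i = ∑ i, R.transitionTo n m i k * b i ∧
      |s * ∑ i, R.direction n m i k * b i| ≤ C * s ∧
      s - volume.real (interior (R.supp (n + m) k)) ≤
        2 * η * volume.real (interior (R.supp (n + m) k)) ∧
      volume.real (interior (R.supp (n + m) k)) ≤ s ∧
      |(∫ x in interior (R.supp (n + m) k), orbit f (S (n + m) k) x) -
        ∑ i, R.transitionTo n m i k * b i| ≤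
        (2 + 6 * C) * η * volume.real (interior (R.supp (n + m) k)) := by
    intro m k hpos
    have hs0 : volume.real (R.supp (n + m) k) ≤ ∑ i, R.transitionTo n m i k * Vn i :=
      volume_supp_le_sum n m k
    have hWs := volume_interior_le (n + m) k
    have hs : 0 < ∑ i, R.transitionTo n m i k * Vn i := hpos.trans_le hs0
    have hsub : (R.pieces n m k : Set (Placed (R.J n) d)) ⊆ (level hrec (S (n + m) k) n).tiles :=
      fun t ht => (mem_level_iff hrec m).2 ⟨_, hS (n + m) k, t, ht, zero_vadd _ t⟩
    have hint : ∀ t ∈ R.pieces n m k,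
        interior (R.tileSupp n t) ⊆ interior (R.supp (n + m) k) := fun t ht =>
      interior_mono (tileSupp_subset_supp ht)
    have key := abs_setIntegral_orbit_sub_sum_le hrec hC hη.le hη1 hmod (fun i => (hn i).2) (hS n)
      hsub (measure_ne_top_of_subset interior_subset (volume_supp_ne_top (n + m) k)) hint (κ := 0)
      (by
        rw [sum_pieces hW m k fun i => volume.real (R.supp n i), add_zero]
        exact hWs.trans hs0)
    rw [sum_pieces hW m k fun i => ∫ x in interior (R.supp n i), orbit f (S n i) x,
      sum_pieces hW m k fun i => volume.real (interior (R.supp n i))] at key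
    have hVW : ∑ i, R.transitionTo n m i k * Vn i - ∑ i, R.transitionTo n m i k * Wn i ≤
        η * ∑ i, R.transitionTo n m i k * Vn i := by
      rw [← Finset.sum_sub_distrib, Finset.mul_sum]
      refine Finset.sum_le_sum fun i _ => ?_
      have h1 := volume_supp_eq n i
      have h2 := volume_frontier_le_cthickening (r := r) n i
      have h3 : Vn i - Wn i ≤ η * Vn i := by
        simp only [Vn, Wn]
        linarith [(hn i).2]
      have := mul_le_mul_of_nonneg_left h3 (transitionTo_nonneg n m i k)
      linarith
    have hdir : ∀ i, (∑ i, R.transitionTo n m i k * Vn i) * R.direction n m i k =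
        R.transitionTo n m i k := fun i => mul_div_cancel₀ _ hs.ne'
    have e : (∑ i, R.transitionTo n m i k * Vn i) * ∑ i, R.direction n m i k * b i =
        ∑ i, R.transitionTo n m i k * b i := by
      rw [Finset.mul_sum]
      exact Finset.sum_congr rfl fun i _ => by rw [← mul_assoc, hdir]
    refine ⟨∑ i, R.transitionTo n m i k * Vn i, hs, e, ?_, ?_, hWs.trans hs0, ?_⟩
    · rw [e, Finset.mul_sum]
      refine (Finset.abs_sum_le_sum_abs _ _).trans (Finset.sum_le_sum fun i _ => ?_)
      rw [abs_mul, abs_of_nonneg (transitionTo_nonneg n m i k), mul_left_comm]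
      refine mul_le_mul_of_nonneg_left ?_ (transitionTo_nonneg n m i k)
      exact (abs_setIntegral_interior_le hC n i _).trans
        (mul_le_mul_of_nonneg_left (volume_interior_le n i) hC0)
    · have h5 : ∑ i, R.transitionTo n m i k * Wn i ≤
          volume.real (interior (R.supp (n + m) k)) := key.2.2
      nlinarith
    · have := key.1
      rwa [mul_zero, add_zero] at this
  have hvol := eventually_vanHove hd hvh hJ 0 one_pos
  have hβ : |∑ i, v i * b i| ≤ C + 1 := by
    obtain ⟨N₀, hN₀⟩ := eventually_atTop.1 hvol
    obtain ⟨k⟩ := hJ (n + (m₀ + N₀))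
    obtain ⟨s, hs, -, h1, -⟩ := hmain (m₀ + N₀) k (hN₀ _ (by omega) k).1
    have h2 := hD (m₀ + N₀) (by omega) k
    rw [abs_mul, abs_of_pos hs, mul_comm] at h1
    have h3 := le_of_mul_le_mul_right h1 hs
    rw [abs_sub_comm] at h2
    have h4 := abs_sub_abs_le_abs_sub (∑ i, v i * b i) (∑ i, R.direction n (m₀ + N₀) i k * b i)
    linarith
  refine ⟨∑ i, v i * b i, hβ, ?_⟩
  filter_upwards [hvol, eventually_ge_atTop (n + m₀)] with N hN hNm k
  obtain ⟨m, rfl⟩ := Nat.exists_eq_add_of_le (le_of_add_le_left hNm)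
  obtain ⟨s, hs, e, -, h2, h3, h4⟩ := hmain m k (hN k).1
  have h5 := hD m (by omega) k
  set w := volume.real (interior (R.supp (n + m) k))
  set β := ∑ i, v i * b i
  have hw : 0 ≤ w := measureReal_nonneg
  have h6 : |∑ i, R.transitionTo n m i k * b i - s * β| ≤ s * η := by
    rw [← e, ← mul_sub, abs_mul, abs_of_pos hs]
    exact mul_le_mul_of_nonneg_left h5 hs.le
  have h7 : |s * β - β * w| ≤ (C + 1) * (2 * η * w) := by
    rw [mul_comm s, ← mul_sub, abs_mul, abs_of_nonneg (sub_nonneg.2 h3)]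
    exact mul_le_mul hβ h2 (sub_nonneg.2 h3) (by positivity)
  have h8 := abs_sub_le (∫ x in interior (R.supp (n + m) k), orbit f (S (n + m) k) x)
    (∑ i, R.transitionTo n m i k * b i) (β * w)
  have h9 := abs_sub_le (∑ i, R.transitionTo n m i k * b i) (s * β) (β * w)
  have h10 : s * η ≤ 2 * w * η := by nlinarith
  have h11 := mul_le_mul_of_nonneg_right hη2 hw
  nlinarith

/-- If the direction matrices are asymptotically rank one, then the averages of a continuous
function over the translates of any tiling by a large supertile nearly agree. -/
theorem exists_average_translates [CompactSpace (FusionTiling R 0)] (hd : 0 < d)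
    (hprim : R.IsPrimitive) (hvh : R.IsVanHove) (hrec : R.IsRecognizable)
    (hone : ∀ n, R.AsymptoticallyRankOne n) (T₀ : FusionTiling R 0) (f : C(FusionTiling R 0, ℝ))
    {ε : ℝ} (hε : 0 < ε) :
    ∃ β, ∀ᶠ N in atTop, ∀ k, ∀ T : FusionTiling R 0,
      0 < volume.real (R.supp N k) ∧
      |(∫ x in R.supp N k, orbit f T x) - β * volume.real (R.supp N k)| ≤
      ε * volume.real (R.supp N k) := by
  obtain ⟨C, hC⟩ : ∃ C, ∀ T, |f T| ≤ C := ⟨‖f‖, fun T => f.norm_coe_le_norm T⟩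
  have hC0 : 0 ≤ C := (abs_nonneg _).trans (hC T₀)
  have hJ := nonempty_fin T₀ hrec
  choose S hS using exists_base hprim hrec T₀
  -- The errors made below add up to `(6 + 10 * C) * η` times the volume.
  obtain ⟨η, hη, hη1, hη2⟩ : ∃ η > 0, η ≤ 1 / 2 ∧ (6 + 10 * C) * η ≤ ε := by
    refine ⟨min (1 / 2) (ε / (6 + 10 * C)), by positivity, min_le_left _ _, ?_⟩
    refine (mul_le_mul_of_nonneg_left (min_le_right _ _) (by positivity)).trans_eq ?_
    field_simp
  obtain ⟨β, hβ, hav⟩ := exists_average_supertiles hd hvh hrec hone hC hS hJ hη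
  obtain ⟨r, hmod⟩ := exists_radius f hη
  -- The level `n` is fixed from here on, and the averaging sets `E` are much larger supertiles.
  obtain ⟨n, hnav, hn, hint⟩ := (hav.and ((eventually_vanHove hd hvh hJ r hη).and
    (eventually_volume_interior_pos hd hvh hJ))).exists
  obtain ⟨D, hD0, hD⟩ := R.exists_supp_subset_closedBall n
  refine ⟨β, ?_⟩
  filter_upwards [eventually_vanHove hd hvh hJ (2 * D) hη] with N hN k T
  refine ⟨(hN k).1, ?_⟩
  set E := R.supp N k
  have hEfin : volume E ≠ ⊤ := volume_supp_ne_top N k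
  have hfin : {s ∈ (level hrec T n).tiles | R.tileSupp n s ⊆ E}.Finite := by
    obtain ⟨ρ, hρ⟩ := (R.isCompact_supp N k).isBounded.subset_closedBall 0
    obtain ⟨B, hB⟩ := exists_card_le_of_isPacking hint ρ
    refine finite_of_forall_card_le (B := B) fun F hF => hB F
      ((level hrec T n).packing.mono fun s hs => (hF hs).1) fun s hs => ?_
    rw [inter_eq_left.2 ((hF hs).2.trans hρ)]
    exact R.nonempty_tileSupp n s
  set F := hfin.toFinset
  have hFmem : ∀ s, s ∈ F ↔ s ∈ (level hrec T n).tiles ∧ R.tileSupp n s ⊆ E := fun s =>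
    hfin.mem_toFinset
  have hcover : E ⊆ (⋃ s ∈ F, R.tileSupp n s) ∪ Metric.cthickening (2 * D) (frontier E) := by
    intro x hx
    obtain ⟨s, hs, hxs⟩ := exists_mem_tiles (level hrec T n) x
    by_cases hsE : R.tileSupp n s ⊆ E
    · exact Or.inl (mem_biUnion ((hFmem s).2 ⟨hs, hsE⟩) hxs)
    · right
      obtain ⟨y, hy, hyE⟩ := not_subset.1 hsE
      refine (mem_cthickening_frontier hx hyE ?_).1
      rw [dist_comm]
      exact tileSupp_subset_closedBall hD hxs hy
  have hκ : volume.real E ≤ (∑ s ∈ F, volume.real (R.supp n s.idx)) + η * volume.real E := by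
    have hUfin : volume (⋃ s ∈ F, R.tileSupp n s) ≠ ⊤ :=
      (F.isCompact_biUnion fun s _ => R.isCompact_tileSupp n s).measure_ne_top
    refine (measureReal_mono hcover (measure_union_ne_top hUfin
      (volume_cthickening_ne_top _ N k))).trans ((measureReal_union_le _ _).trans ?_)
    refine add_le_add ((measureReal_biUnion_finset_le _ _).trans_eq ?_) (hN k).2
    exact Finset.sum_congr rfl fun s _ => by rw [tileSupp, Measure.real, Measure.real, measure_vadd]
  obtain ⟨h1, h2, h3⟩ := abs_setIntegral_orbit_sub_sum_le hrec hC hη.le hη1 hmod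
    (fun i => (hn i).2) (hS n) (F := F) (fun s hs => ((hFmem s).1 hs).1) hEfin
    (fun s hs => interior_subset.trans ((hFmem s).1 hs).2) hκ
  have h4 : |(∑ s ∈ F, ∫ x in interior (R.supp n s.idx), orbit f (S n s.idx) x) -
      β * ∑ s ∈ F, volume.real (interior (R.supp n s.idx))| ≤
      η * ∑ s ∈ F, volume.real (interior (R.supp n s.idx)) := by
    rw [Finset.mul_sum, Finset.mul_sum, ← Finset.sum_sub_distrib]
    exact (Finset.abs_sum_le_sum_abs _ _).trans (Finset.sum_le_sum fun s _ => hnav _)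
  set w := ∑ s ∈ F, volume.real (interior (R.supp n s.idx))
  set b := ∑ s ∈ F, ∫ x in interior (R.supp n s.idx), orbit f (S n s.idx) x
  have hE0 : 0 ≤ volume.real E := measureReal_nonneg
  have h5 : |β * w - β * volume.real E| ≤ (C + 1) * (3 * η * volume.real E) := by
    rw [← mul_sub, abs_mul, abs_sub_comm, abs_of_nonneg (sub_nonneg.2 h3)]
    exact mul_le_mul hβ (by linarith) (sub_nonneg.2 h3) (by positivity)
  have h6 := abs_sub_le (∫ x in E, orbit f T x) b (β * volume.real E)
  have h7 := abs_sub_le b (β * w) (β * volume.real E)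
  have h8 := mul_le_mul_of_nonneg_right hη2 hE0
  have h9 := mul_le_mul_of_nonneg_left h3 hη.le
  nlinarith

/-- For an invariant measure, the integral of a function is the integral of its averages. -/
theorem integral_setIntegral_orbit [CompactSpace (FusionTiling R 0)]
    [T2Space (FusionTiling R 0)] [SecondCountableTopology (FusionTiling R 0)]
    {μ : ProbabilityMeasure (FusionTiling R 0)}
    (hμ : μ ∈ invariantMeasures (Space d) (FusionTiling R 0)) (f : C(FusionTiling R 0, ℝ))
    {E : Set (Space d)} (hE : volume E ≠ ⊤) :
    ∫ T, (∫ x in E, orbit f T x) ∂(μ : Measure (FusionTiling R 0)) =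
      volume.real E * integralFunctional μ f := by
  have hcont : Continuous (Function.uncurry fun (T : FusionTiling R 0) (x : Space d) =>
      orbit f T x) :=
    f.continuous.comp ((continuous_neg.comp continuous_snd).vadd continuous_fst)
  have : IsFiniteMeasure (volume.restrict E) := ⟨by simpa using hE.lt_top⟩
  have hint : Integrable (Function.uncurry fun (T : FusionTiling R 0) (x : Space d) => orbit f T x)
      ((μ : Measure (FusionTiling R 0)).prod (volume.restrict E)) :=
    Integrable.of_bound hcont.aestronglyMeasurable ‖f‖
      (Eventually.of_forall fun p => f.norm_coe_le_norm _)
  rw [integral_integral_swap hint]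
  have h := mem_invariantMeasures_iff.1 hμ
  have h' : ∀ x : Space d, ∫ T, orbit f T x ∂(μ : Measure (FusionTiling R 0)) =
      integralFunctional μ f := fun x => h (-x) f
  simp only [h', setIntegral_const, smul_eq_mul]

/-- If the direction matrices are asymptotically rank one, then there is at most one invariant
probability measure. -/
theorem subsingleton_invariantMeasures [CompactSpace (FusionTiling R 0)]
    [T2Space (FusionTiling R 0)] [SecondCountableTopology (FusionTiling R 0)] (hd : 0 < d)
    (hprim : R.IsPrimitive) (hvh : R.IsVanHove) (hrec : R.IsRecognizable)
    (hone : ∀ n, R.AsymptoticallyRankOne n) :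
    (invariantMeasures (Space d) (FusionTiling R 0)).Subsingleton := by
  intro μ hμ ν hν
  obtain ⟨T₀⟩ := ProbabilityMeasure.nonempty μ
  have hJ := nonempty_fin T₀ hrec
  refine integralFunctional_injective (funext fun f => ?_)
  refine eq_of_forall_dist_le fun ε hε => ?_
  obtain ⟨β, hβ⟩ := exists_average_translates hd hprim hvh hrec hone T₀ f (half_pos hε)
  obtain ⟨N, hN⟩ := hβ.exists
  obtain ⟨k⟩ := hJ N
  have key : ∀ ρ ∈ invariantMeasures (Space d) (FusionTiling R 0),
      |integralFunctional ρ f - β| ≤ ε / 2 := fun ρ hρ => by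
    have hV : 0 < volume.real (R.supp N k) := (hN k T₀).1
    have h1 := integral_setIntegral_orbit hρ f (volume_supp_ne_top N k)
    have hcont : Continuous fun T : FusionTiling R 0 => ∫ x in R.supp N k, orbit f T x := by
      refine continuous_parametric_integral_of_continuous ?_ (R.isCompact_supp N k)
      exact f.continuous.comp ((continuous_neg.comp continuous_snd).vadd continuous_fst)
    have hi : Integrable (fun T : FusionTiling R 0 => ∫ x in R.supp N k, orbit f T x)
        (ρ : Measure (FusionTiling R 0)) :=
      hcont.integrable_of_hasCompactSupport (HasCompactSupport.of_compactSpace _)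
    have h2 : |∫ T, ((∫ x in R.supp N k, orbit f T x) - β * volume.real (R.supp N k))
        ∂(ρ : Measure (FusionTiling R 0))| ≤ ε / 2 * volume.real (R.supp N k) := by
      rw [← Real.norm_eq_abs]
      refine (norm_integral_le_of_norm_le_const (Eventually.of_forall fun T => (hN k T).2)).trans_eq
        ?_
      simp
    rw [integral_sub hi (integrable_const _), h1, integral_const, probReal_univ, one_smul,
      mul_comm β, ← mul_sub, abs_mul, abs_of_pos hV, mul_comm (ε / 2)] at h2
    exact le_of_mul_le_mul_left h2 hV
  have h1 := key μ hμ
  have h2 := key ν hν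
  rw [abs_sub_comm] at h2
  rw [Real.dist_eq]
  exact (abs_sub_le _ β _).trans (by linarith)

end FusionRule

end RankOne

/-! ### Limits of averages over supertiles -/

section Limits

variable {d : ℕ} {R : FusionRule d}

open FusionData FusionRule FusionTiling

namespace FusionRule

/-- The image of normalized volume on `E` along an orbit. -/
theorem exists_orbit_measure [CompactSpace (FusionTiling R 0)] (S : FusionTiling R 0)
    {E : Set (Space d)} (hE : volume E ≠ ⊤) (hE0 : 0 < volume.real E) :
    ∃ P : ProbabilityMeasure (FusionTiling R 0), ∀ f : C(FusionTiling R 0, ℝ),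
      integralFunctional P f = (volume.real E)⁻¹ * ∫ x in E, orbit f S x := by
  have h0 : volume E ≠ 0 := fun h => by simp [Measure.real, h] at hE0
  have : IsProbabilityMeasure (ProbabilityTheory.cond volume E) :=
    ProbabilityTheory.cond_isProbabilityMeasure_of_finite h0 hE
  have hc : Continuous fun x : Space d => -x +ᵥ S := continuous_neg.vadd continuous_const
  refine ⟨⟨(ProbabilityTheory.cond volume E).map fun x : Space d => -x +ᵥ S,
    Measure.isProbabilityMeasure_map hc.measurable.aemeasurable⟩, fun f => ?_⟩
  change ∫ T, f T ∂((ProbabilityTheory.cond volume E).map fun x : Space d => -x +ᵥ S) = _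
  rw [integral_map hc.measurable.aemeasurable f.continuous.aestronglyMeasurable,
    ProbabilityTheory.cond, integral_smul_measure, ENNReal.toReal_inv]
  rfl

/-- The limits of averages over larger and larger supertiles are integrals with respect to
invariant measures, by the van Hove property. -/
theorem exists_mem_invariantMeasures_tendsto [CompactSpace (FusionTiling R 0)]
    [T2Space (FusionTiling R 0)] [SecondCountableTopology (FusionTiling R 0)] (hd : 0 < d)
    (hvh : R.IsVanHove) (hJ : ∀ n, Nonempty (Fin (R.J n))) {ι : Type*} (𝒰 : Ultrafilter ι)
    {N : ι → ℕ} (hN : Tendsto N 𝒰 atTop) (k : ∀ a, Fin (R.J (N a))) (S : ι → FusionTiling R 0) :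
    ∃ μ ∈ invariantMeasures (Space d) (FusionTiling R 0), ∀ f : C(FusionTiling R 0, ℝ),
      Tendsto (fun a => (volume.real (R.supp (N a) (k a)))⁻¹ *
        ∫ x in R.supp (N a) (k a), orbit f (S a) x) 𝒰 (𝓝 (integralFunctional μ f)) := by
  have hex : ∀ a, ∃ P : ProbabilityMeasure (FusionTiling R 0),
      0 < volume.real (R.supp (N a) (k a)) → ∀ f : C(FusionTiling R 0, ℝ),
        integralFunctional P f = (volume.real (R.supp (N a) (k a)))⁻¹ *
          ∫ x in R.supp (N a) (k a), orbit f (S a) x := fun a => by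
    by_cases h : 0 < volume.real (R.supp (N a) (k a))
    · obtain ⟨P, hP⟩ := exists_orbit_measure (S a) (volume_supp_ne_top (N a) (k a)) h
      exact ⟨P, fun _ => hP⟩
    -- Volume zero is possible at low levels only, so that any measure will do.
    · exact ⟨⟨Measure.dirac (S a), inferInstance⟩, fun h' => absurd h' h⟩
  choose P hP using hex
  obtain ⟨μ, -, hμ⟩ := isCompact_iff_ultrafilter_le_nhds.1 isCompact_univ (𝒰.map P)
    (by simp)
  have hμ' : Tendsto P 𝒰 (𝓝 μ) := hμ
  have hvan : ∀ (r : ℝ) {ε : ℝ}, 0 < ε → ∀ᶠ a in (𝒰 : Filter ι),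
      0 < volume.real (R.supp (N a) (k a)) ∧
      volume.real (Metric.cthickening r (frontier (R.supp (N a) (k a)))) ≤
        ε * volume.real (R.supp (N a) (k a)) := fun r ε hε => by
    filter_upwards [hN.eventually (eventually_vanHove hd hvh hJ r hε)] with a ha
    exact ha (k a)
  have hlim : ∀ f : C(FusionTiling R 0, ℝ),
      Tendsto (fun a => (volume.real (R.supp (N a) (k a)))⁻¹ *
        ∫ x in R.supp (N a) (k a), orbit f (S a) x) 𝒰 (𝓝 (integralFunctional μ f)) := by
    intro f
    -- The averages are integrals with respect to `P a` as soon as the volume is positive.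
    have h1 : Tendsto (fun a => integralFunctional (P a) f) 𝒰 (𝓝 (integralFunctional μ f)) :=
      (ProbabilityMeasure.continuous_integral_continuousMap f).continuousAt.tendsto.comp hμ'
    refine h1.congr' ?_
    filter_upwards [hvan 0 one_pos] with a ha
    exact hP a ha.1 f
  refine ⟨μ, mem_invariantMeasures_iff.2 fun v f => ?_, hlim⟩
  refine eq_of_forall_dist_le fun ε hε => ?_
  rw [Real.dist_eq]
  refine le_of_tendsto ((hlim _).sub (hlim f)).abs ?_
  filter_upwards [hvan ‖v‖ (show 0 < ε / (‖f‖ + 1) by positivity)] with a ha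
  have h1 := abs_setIntegral_translate_sub_le (R.isCompact_supp (N a) (k a))
    (continuous_orbit f (S a)) (C := ‖f‖) (fun x => f.norm_coe_le_norm _) v
  have h2 : ∀ x, orbit (f.comp ⟨fun T => v +ᵥ T, continuous_const_vadd v⟩) (S a) x =
      orbit f (S a) (x - v) := fun x => by
    change f (v +ᵥ (-x +ᵥ S a)) = f (-(x - v) +ᵥ S a)
    rw [← add_vadd]
    congr 2
    abel
  simp only [h2]
  rw [← mul_sub, abs_mul, abs_of_pos (inv_pos.2 ha.1), inv_mul_le_iff₀ ha.1]
  refine h1.trans ((mul_le_mul_of_nonneg_left ha.2 (norm_nonneg f)).trans ?_)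
  have h3 : ‖f‖ * (ε / (‖f‖ + 1)) ≤ ε := by
    rw [mul_div_assoc', div_le_iff₀ (by positivity)]
    nlinarith [norm_nonneg f]
  nlinarith

/-! ### Functions that count supertiles -/

open Classical in
/-- The sum of the values `φ (-p)` over the supertiles of type `i` of the tiling, where `p` is the
position. It is written as a single value, since `φ` will vanish outside the interior of the
`i`-th supertile, so that at most one summand is not zero. -/
noncomputable def detector {n : ℕ} (φ : Space d → ℝ) (i : Fin (R.J n)) (T : FusionTiling R n) : ℝ :=
  if h : ∃ t ∈ T.tiles, t.idx = i ∧ φ (-t.pos) ≠ 0 then φ (-h.choose.pos) else 0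

section Detector

variable {n : ℕ} {φ : Space d → ℝ} {i : Fin (R.J n)} {T : FusionTiling R n}

theorem zero_mem_interior_tileSupp (hφ : ∀ x, φ x ≠ 0 → x ∈ interior (R.supp n i))
    {t : Placed (R.J n) d} (hi : t.idx = i) (ht : φ (-t.pos) ≠ 0) :
    (0 : Space d) ∈ interior (R.tileSupp n t) := by
  rw [interior_tileSupp, mem_vadd_set_iff_neg_vadd_mem, vadd_eq_add, add_zero, hi]
  exact hφ _ ht

theorem detector_eq (hφ : ∀ x, φ x ≠ 0 → x ∈ interior (R.supp n i)) {t : Placed (R.J n) d}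
    (ht : t ∈ T.tiles) (hi : t.idx = i) (h : φ (-t.pos) ≠ 0) :
    detector φ i T = φ (-t.pos) := by
  have hex : ∃ t ∈ T.tiles, t.idx = i ∧ φ (-t.pos) ≠ 0 := ⟨t, ht, hi, h⟩
  rw [detector, dif_pos hex]
  obtain ⟨h1, h2, h3⟩ := hex.choose_spec
  by_cases e : hex.choose = t
  · rw [e]
  · exact absurd (interior_subset (zero_mem_interior_tileSupp hφ hi h))
      (Set.disjoint_left.1 (T.packing h1 ht e).disjoint_interior
        (zero_mem_interior_tileSupp hφ h2 h3))

theorem le_detector (hφ : ∀ x, φ x ≠ 0 → x ∈ interior (R.supp n i)) (hφ0 : ∀ x, 0 ≤ φ x)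
    {t : Placed (R.J n) d} (ht : t ∈ T.tiles) (hi : t.idx = i) :
    φ (-t.pos) ≤ detector φ i T := by
  by_cases h : φ (-t.pos) = 0
  · rw [h, detector]
    split_ifs
    exacts [hφ0 _, le_rfl]
  · exact (detector_eq hφ ht hi h).ge

theorem detector_le_of_close (hφ : ∀ x, φ x ≠ 0 → x ∈ interior (R.supp n i)) (hφ0 : ∀ x, 0 ≤ φ x)
    {ε η : ℝ} (hε : 0 < ε) (hε1 : ε ≤ 1) (hη : 0 ≤ η)
    (hmod : ∀ x y, ‖x - y‖ ≤ 2 * ε → |φ x - φ y| ≤ η) {T' : FusionTiling R n}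
    (h : Close ε T T') : detector φ i T ≤ detector φ i T' + η := by
  by_cases hex : ∃ t ∈ T.tiles, t.idx = i ∧ φ (-t.pos) ≠ 0
  · obtain ⟨t, ht, hi, htφ⟩ := hex
    rw [detector_eq hφ ht hi htφ]
    obtain ⟨g, g', hg, hg', e⟩ := h
    have h0 := interior_subset (zero_mem_interior_tileSupp hφ hi htφ)
    have hgt : g +ᵥ t ∈ R.patchAt n (1 / ε) (g +ᵥ T.tiles) := by
      refine ⟨vadd_mem_vadd_set ht, g, ?_, ?_⟩
      · rw [tileSupp_vadd]
        exact ⟨0, h0, add_zero g⟩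
      · rw [mem_closedBall_zero_iff, le_div_iff₀ hε]
        nlinarith [norm_nonneg g]
    rw [e] at hgt
    obtain ⟨u, hu, eu⟩ := hgt.1
    have eu' : g' +ᵥ u = g +ᵥ t := eu
    have eu1 : u.idx = t.idx := (Placed.ext_iff.1 eu').1
    have eu2 : g' + u.pos = g + t.pos := (Placed.ext_iff.1 eu').2
    have h1 := le_detector hφ hφ0 hu (eu1.trans hi)
    have h2 := hmod (-t.pos) (-u.pos) (by
      have : -t.pos - -u.pos = g - g' := by
        rw [neg_sub_neg, sub_eq_sub_iff_add_eq_add, add_comm, eu2]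
      rw [this]
      linarith [norm_sub_le g g'])
    linarith [le_abs_self (φ (-t.pos) - φ (-u.pos))]
  · have h1 : detector φ i T = 0 := dif_neg hex
    have h2 : 0 ≤ detector φ i T' := by
      rw [detector]
      split_ifs
      exacts [hφ0 _, le_rfl]
    linarith

theorem continuous_detector (hφ : ∀ x, φ x ≠ 0 → x ∈ interior (R.supp n i)) (hφ0 : ∀ x, 0 ≤ φ x)
    (hc : Continuous φ) (hs : HasCompactSupport φ) :
    Continuous (detector φ i : FusionTiling R n → ℝ) := by
  have hu := hs.uniformContinuous_of_continuous hc
  rw [continuous_iff_continuousAt]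
  intro T
  refine ((hasBasis_nhds T).tendsto_iff Metric.nhds_basis_closedBall).2 fun η hη => ?_
  obtain ⟨δ, hδ, H⟩ := Metric.uniformContinuous_iff_le.1 hu η hη
  have hε : 0 < min (δ / 2) 1 := by positivity
  have h2 : 2 * min (δ / 2) 1 ≤ δ := by linarith [min_le_left (δ / 2) 1]
  have hmod : ∀ x y, ‖x - y‖ ≤ 2 * min (δ / 2) 1 → |φ x - φ y| ≤ η := fun x y hxy => by
    rw [← Real.dist_eq]
    exact H (by rw [dist_eq_norm]; exact hxy.trans h2)
  refine ⟨min (δ / 2) 1, hε, fun T' hT' => ?_⟩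
  have h3 := detector_le_of_close hφ hφ0 hε (min_le_right _ _) hη.le hmod hT'
  have h4 := detector_le_of_close hφ hφ0 hε (min_le_right _ _) hη.le hmod (Close.symm hT')
  rw [Metric.mem_closedBall, Real.dist_eq, abs_le]
  constructor <;> linarith

end Detector

theorem exists_bump {U : Set (Space d)} (hU : IsOpen U) (hne : U.Nonempty) :
    ∃ φ : Space d → ℝ, Continuous φ ∧ HasCompactSupport φ ∧ (∀ x, 0 ≤ φ x) ∧
      (∀ x, φ x ≠ 0 → x ∈ U) ∧ ∫ x, φ x = 1 := by
  obtain ⟨c, hc⟩ := hne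
  obtain ⟨δ, hδ, hball⟩ := Metric.isOpen_iff.1 hU c hc
  let b : ContDiffBump c := ⟨δ / 2, δ, half_pos hδ, half_lt_self hδ⟩
  refine ⟨b.normed volume, b.continuous_normed, b.hasCompactSupport_normed, b.nonneg_normed,
    fun x hx => hball ?_, b.integral_normed⟩
  have : x ∈ Function.support (b.normed volume) := hx
  rwa [b.support_normed_eq] at this

/-- The integral of the detector over the orbit piece of a supertile is an entry of the transition
matrix. There is no boundary error, since the bump functions live inside the supertiles. -/
theorem setIntegral_detector (hrec : R.IsRecognizable) {n m : ℕ}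
    (hint : ∀ j, 0 < volume.real (interior (R.supp n j))) {φ : Space d → ℝ} {i : Fin (R.J n)}
    (hc : Continuous φ) (hs : HasCompactSupport φ) (h1 : ∫ x, φ x = 1)
    (hφ : ∀ x, φ x ≠ 0 → x ∈ interior (R.supp n i)) {k : Fin (R.J (n + m))} {S : FusionTiling R 0}
    (hS : (⟨k, 0⟩ : Placed (R.J (n + m)) d) ∈ (level hrec S (n + m)).tiles) :
    ∫ x in R.supp (n + m) k, detector φ i (level hrec (-x +ᵥ S) n) =
      R.transitionTo n m i k := by
  classical
  have hmem : ∀ t ∈ R.pieces n m k, t ∈ (level hrec S n).tiles := fun t ht =>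
    (mem_level_iff hrec m).2 ⟨_, hS, t, ht, zero_vadd _ t⟩
  have hpt : ∀ x ∈ R.supp (n + m) k, detector φ i (level hrec (-x +ᵥ S) n) =
      ∑ t ∈ R.pieces n m k, if t.idx = i then φ (x - t.pos) else 0 := by
    intro x hx
    rw [level_vadd]
    have hval : ∀ t : Placed (R.J n) d, φ (-(-x +ᵥ t).pos) = φ (x - t.pos) := fun t => by
      change φ (-(-x + t.pos)) = _
      congr 1
      abel
    by_cases hex : ∃ t ∈ R.pieces n m k, t.idx = i ∧ φ (x - t.pos) ≠ 0
    · obtain ⟨t, ht, hti, htφ⟩ := hex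
      rw [detector_eq hφ (t := -x +ᵥ t) (vadd_mem_vadd_set (hmem t ht)) hti (by rwa [hval]),
        hval, Finset.sum_eq_single_of_mem t ht, if_pos hti]
      intro u hu hut
      split_ifs with hui
      · by_contra h
        have hu0 := zero_mem_interior_tileSupp hφ (t := -x +ᵥ u) hui (by rwa [hval])
        have ht0 := zero_mem_interior_tileSupp hφ (t := -x +ᵥ t) hti (by rwa [hval])
        exact Set.disjoint_left.1 ((level hrec (-x +ᵥ S) n).packing
          (by rw [level_vadd]; exact vadd_mem_vadd_set (hmem u hu))
          (by rw [level_vadd]; exact vadd_mem_vadd_set (hmem t ht))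
          fun e => hut (vadd_left_cancel _ e)).disjoint_interior hu0 (interior_subset ht0)
      · rfl
    · push Not at hex
      rw [Finset.sum_eq_zero fun t ht => by
        split_ifs with hti
        exacts [hex t ht hti, rfl]]
      refine dif_neg ?_
      rintro ⟨_, ⟨t, ht, rfl⟩, hti, htφ⟩
      obtain ⟨s, hs', q, hq, rfl⟩ := (mem_level_iff hrec m).1 ht
      have hxs : x ∈ interior (R.tileSupp n (s.pos +ᵥ q)) := by
        rw [interior_tileSupp, show (s.pos +ᵥ q).idx = i from hti]
        exact ⟨x - (s.pos +ᵥ q).pos, hφ _ ((hval _).symm.trans_ne htφ), add_sub_cancel _ _⟩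
      have hsk : s = ⟨k, 0⟩ := by
        by_contra hne
        refine Set.disjoint_left.1 ((level hrec S (n + m)).packing hs' hS hne).disjoint_interior
          (interior_mono (tileSupp_piece_subset hq) hxs) ?_
        rwa [tileSupp_zero_pos]
      subst hsk
      have e : (0 : Space d) +ᵥ q = q := zero_vadd _ q
      simp only [e] at hti htφ
      exact htφ ((hval q).trans (hex q hq hti))
  rw [setIntegral_congr_fun (measurableSet_supp (n + m) k) hpt, integral_finsetSum]
  · have hone : ∀ t ∈ R.pieces n m k, ∫ x in R.supp (n + m) k,
        (if t.idx = i then φ (x - t.pos) else 0) = if t.idx = i then 1 else 0 := by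
      intro t ht
      split_ifs with hti
      · rw [setIntegral_eq_integral_of_forall_compl_eq_zero, integral_sub_right_eq_self φ, h1]
        intro x hx
        by_contra hne
        refine hx (tileSupp_subset_supp ht ?_)
        have := interior_subset (hφ _ hne)
        rw [← hti] at this
        exact ⟨x - t.pos, this, add_sub_cancel _ _⟩
      · simp
    rw [Finset.sum_congr rfl hone, sum_pieces hint m k fun j => if j = i then 1 else 0]
    simp
  · intro t ht
    split_ifs
    · exact ((hc.comp (continuous_id.sub continuous_const)).integrable_of_hasCompactSupport
        (hs.comp_homeomorph (Homeomorph.subRight t.pos))).integrableOn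
    · exact integrable_zero _ _ _

/-- If there is only one invariant probability measure, then the frequencies of `n`-supertiles in
large supertiles converge, for all levels `n` at which the supertiles have interior points. -/
theorem tendsto_frequency [CompactSpace (FusionTiling R 0)]
    [T2Space (FusionTiling R 0)] [SecondCountableTopology (FusionTiling R 0)] (hd : 0 < d)
    (hprim : R.IsPrimitive) (hvh : R.IsVanHove) (hrec : R.IsRecognizable) (T₀ : FusionTiling R 0)
    (huniq : (invariantMeasures (Space d) (FusionTiling R 0)).Subsingleton)
    {μ : ProbabilityMeasure (FusionTiling R 0)}
    (hμ : μ ∈ invariantMeasures (Space d) (FusionTiling R 0)) {n : ℕ}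
    (hint : ∀ j, 0 < volume.real (interior (R.supp n j))) (i : Fin (R.J n)) :
    ∃ ρ : ℝ, Tendsto (fun a : Σ m, Fin (R.J (n + m)) =>
      (volume.real (R.supp (n + a.1) a.2))⁻¹ * R.transitionTo n a.1 i a.2)
      (comap Sigma.fst atTop) (𝓝 ρ) := by
  have hJ := nonempty_fin T₀ hrec
  obtain ⟨φ, hc, hs, hφ0, hφ, h1⟩ := exists_bump
    (U := interior (R.supp n i)) isOpen_interior (nonempty_iff_ne_empty.2 fun e => by
    have := hint i
    simp [e] at this)
  let f : C(FusionTiling R 0, ℝ) := ⟨fun T => detector φ i (level hrec T n),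
    (continuous_detector hφ hφ0 hc hs).comp (continuous_level hrec n)⟩
  choose S hS using exists_base hprim hrec T₀
  refine ⟨integralFunctional μ f, tendsto_iff_ultrafilter _ _ _ |>.2 fun 𝒰 h𝒰 => ?_⟩
  have hN : Tendsto (fun a : Σ m, Fin (R.J (n + m)) => n + a.1) 𝒰 atTop :=
    tendsto_atTop_mono (fun a => Nat.le_add_left a.1 n) (tendsto_comap.mono_left h𝒰)
  obtain ⟨ν, hν, hlim⟩ := exists_mem_invariantMeasures_tendsto hd hvh hJ 𝒰 hN (fun a => a.2)
    fun a => S (n + a.1) a.2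
  rw [huniq hμ hν]
  refine (hlim f).congr fun a => ?_
  congr 1
  exact setIntegral_detector hrec hint hc hs h1 hφ (hS (n + a.1) a.2)

end FusionRule

end Limits

/-! ### From frequencies to direction matrices -/

section Direction

variable {d : ℕ}

open FusionData FusionRule FusionTiling

theorem FusionData.transition_cast (R : FusionData d) {a b : ℕ} (h : a = b) (j : Fin (R.J a))
    (k : Fin (R.J (a + 1))) :
    R.transition b (j.cast (congrArg R.J h)) (k.cast (congrArg (fun a => R.J (a + 1)) h)) =
      R.transition a j k := by
  subst h
  rfl

theorem FusionData.supp_cast (R : FusionData d) {a b : ℕ} (h : a = b) (j : Fin (R.J a)) :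
    R.supp b (j.cast (congrArg R.J h)) = R.supp a j := by
  subst h
  rfl

/-- `M_{n,n+q+m} = M_{n,n+q} M_{n+q,n+q+m}`. -/
theorem FusionData.transitionTo_add (R : FusionData d) (n q m : ℕ) (i : Fin (R.J n))
    (k : Fin (R.J (n + (q + m)))) :
    R.transitionTo n (q + m) i k = ∑ l, R.transitionTo n q i l *
      R.transitionTo (n + q) m l (k.cast (congrArg R.J (add_assoc n q m).symm)) := by
  induction m with
  | zero =>
    change R.transitionTo n q i k =
      ∑ l, R.transitionTo n q i l * (1 : Matrix (Fin (R.J (n + q))) (Fin (R.J (n + q))) ℝ) l k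
    simp [Matrix.one_apply]
  | succ m ih =>
    have e1 : R.transitionTo n (q + (m + 1)) i k =
        ∑ j, R.transitionTo n (q + m) i j * R.transition (n + (q + m)) j k := rfl
    have e2 : ∀ l k, R.transitionTo (n + q) (m + 1) l k =
        ∑ j, R.transitionTo (n + q) m l j * R.transition (n + q + m) j k := fun l k => rfl
    simp only [e1, e2, ih, Finset.sum_mul, Finset.mul_sum]
    rw [Finset.sum_comm]
    refine Finset.sum_congr rfl fun l _ => ?_
    refine Fintype.sum_equiv (finCongr (congrArg R.J (add_assoc n q m).symm)) _ _ fun j => ?_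
    rw [mul_assoc]
    congr 2
    exact (R.transition_cast (add_assoc n q m).symm j k).symm

variable {R : FusionRule d}

/-- The filter `comap Sigma.fst atTop` expresses convergence as `m → ∞`, uniformly in the index of
the supertile. -/
theorem eventually_comap_sigma {J : ℕ → Type*} {p : (Σ m, J m) → Prop} :
    (∀ᶠ a in comap Sigma.fst atTop, p a) ↔ ∃ m₀, ∀ m ≥ m₀, ∀ k : J m, p ⟨m, k⟩ := by
  rw [eventually_comap, eventually_atTop]
  constructor
  · rintro ⟨m₀, h⟩
    exact ⟨m₀, fun m hm k => h m hm ⟨m, k⟩ rfl⟩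
  · rintro ⟨m₀, h⟩
    refine ⟨m₀, ?_⟩
    rintro _ hm ⟨m, k⟩ rfl
    exact h m hm k

/-- If the frequencies of `(n+q)`-supertiles in large supertiles converge, then so do those of
`n`-supertiles, and therefore the columns of the direction matrices. -/
theorem FusionRule.asymptoticallyRankOne_of_tendsto_frequency (hd : 0 < d) (hvh : R.IsVanHove)
    (hJ : ∀ n, Nonempty (Fin (R.J n))) {n q : ℕ} {ρ : Fin (R.J (n + q)) → ℝ}
    (h : ∀ l, Tendsto (fun a : Σ m, Fin (R.J (n + q + m)) =>
      (volume.real (R.supp (n + q + a.1) a.2))⁻¹ * R.transitionTo (n + q) a.1 l a.2)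
      (comap Sigma.fst atTop) (𝓝 (ρ l))) :
    R.AsymptoticallyRankOne n := by
  let c : (Σ m, Fin (R.J (n + (q + m)))) → Σ m, Fin (R.J (n + q + m)) := fun a =>
    ⟨a.1, a.2.cast (congrArg R.J (add_assoc n q a.1).symm)⟩
  have hc : Tendsto c (comap Sigma.fst atTop) (comap Sigma.fst atTop) :=
    tendsto_comap_iff.2 tendsto_comap
  have hne : NeBot (comap (Sigma.fst : (Σ m, Fin (R.J (n + (q + m)))) → ℕ) atTop) :=
    NeBot.comap_of_surj atTop_neBot fun m => ⟨⟨m, Classical.choice (hJ _)⟩, rfl⟩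
  let V : (Σ m, Fin (R.J (n + (q + m)))) → ℝ := fun a => volume.real (R.supp (n + (q + a.1)) a.2)
  have hV : ∀ᶠ a in comap Sigma.fst atTop, 0 < V a := by
    obtain ⟨N₀, hN₀⟩ := eventually_atTop.1 (eventually_vanHove hd hvh hJ 0 one_pos)
    exact eventually_comap_sigma.2 ⟨N₀, fun m hm k => (hN₀ _ (by omega) k).1⟩
  have hfreq : ∀ i, Tendsto (fun a : Σ m, Fin (R.J (n + (q + m))) =>
      (V a)⁻¹ * R.transitionTo n (q + a.1) i a.2) (comap Sigma.fst atTop)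
      (𝓝 (∑ l, R.transitionTo n q i l * ρ l)) := fun i => by
    have h1 := tendsto_finsetSum Finset.univ fun l _ =>
      ((h l).comp hc).const_mul (R.transitionTo n q i l)
    refine h1.congr fun a => ?_
    rw [R.transitionTo_add, Finset.mul_sum]
    refine Finset.sum_congr rfl fun l _ => ?_
    have e : R.supp (n + q + (c a).1) (c a).2 = R.supp (n + (q + a.1)) a.2 :=
      R.supp_cast (add_assoc n q a.1).symm a.2
    change R.transitionTo n q i l * ((volume.real (R.supp (n + q + (c a).1) (c a).2))⁻¹ * _) = _
    rw [e, mul_left_comm]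
  have htot : Tendsto (fun a : Σ m, Fin (R.J (n + (q + m))) =>
      (V a)⁻¹ * ∑ i, R.transitionTo n (q + a.1) i a.2 * volume.real (R.supp n i))
      (comap Sigma.fst atTop)
      (𝓝 (∑ i, (∑ l, R.transitionTo n q i l * ρ l) * volume.real (R.supp n i))) := by
    refine (tendsto_finsetSum Finset.univ fun i _ =>
      (hfreq i).mul_const (volume.real (R.supp n i))).congr fun a => ?_
    rw [Finset.mul_sum]
    exact Finset.sum_congr rfl fun i _ => mul_assoc _ _ _
  -- The volumes of the pieces add up to at least the volume of the supertile.
  have hpos : 1 ≤ ∑ i, (∑ l, R.transitionTo n q i l * ρ l) * volume.real (R.supp n i) := by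
    refine ge_of_tendsto htot ?_
    filter_upwards [hV] with a ha
    rw [inv_mul_eq_div, one_le_div ha]
    exact volume_supp_le_sum n (q + a.1) a.2
  refine ⟨fun i => (∑ l, R.transitionTo n q i l * ρ l) /
    ∑ i, (∑ l, R.transitionTo n q i l * ρ l) * volume.real (R.supp n i), fun ε hε => ?_⟩
  have hlim : ∀ i, ∀ᶠ a : Σ m, Fin (R.J (n + (q + m))) in comap Sigma.fst atTop,
      |R.direction n (q + a.1) i a.2 - (∑ l, R.transitionTo n q i l * ρ l) /
        ∑ i, (∑ l, R.transitionTo n q i l * ρ l) * volume.real (R.supp n i)| < ε := fun i => by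
    filter_upwards [hV, ((hfreq i).div htot (by linarith)).eventually (Metric.ball_mem_nhds _ hε)]
      with a ha h1
    rw [← Real.dist_eq]
    convert h1 using 2
    rw [Pi.div_apply, mul_div_mul_left _ _ (inv_ne_zero ha.ne')]
    rfl
  obtain ⟨m₀, hm₀⟩ := eventually_comap_sigma.1 (eventually_all.2 hlim)
  refine ⟨q + m₀, fun m hm k i => ?_⟩
  obtain ⟨m', rfl⟩ := Nat.exists_eq_add_of_le (le_of_add_le_left hm)
  exact hm₀ m' (by omega) k i

end Direction

/-! ### The criterion for unique ergodicity -/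

theorem mainTheorem3 {d : ℕ} (hd : 0 < d) (R : FusionRule d)
    (hne : Nonempty (FusionTiling R 0))
    (hflc : ∀ T : FusionTiling R 0, R.HasFLC T.tiles)
    (hprim : R.IsPrimitive) (hvh : R.IsVanHove) (hrec : R.IsRecognizable) :
    UniquelyErgodic (Space d) (FusionTiling R 0) ↔ ∀ n, R.AsymptoticallyRankOne n := by
  have : CompactSpace (FusionTiling R 0) := FusionTiling.compactSpace hd hflc hprim hvh hrec
  have : T2Space (FusionTiling R 0) := FusionTiling.t2Space hd hvh hrec
  have : SecondCountableTopology (FusionTiling R 0) := FusionTiling.secondCountableTopology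
  obtain ⟨T₀⟩ := hne
  have hJ := FusionRule.nonempty_fin T₀ hrec
  rw [uniquelyErgodic_iff_existsUnique_mem_invariantMeasures]
  constructor
  · rintro ⟨μ, hμ, huniq⟩ n
    obtain ⟨q, hq⟩ := eventually_atTop.1 (FusionRule.eventually_volume_interior_pos hd hvh hJ)
    choose ρ hρ using FusionRule.tendsto_frequency hd hprim hvh hrec T₀
      (fun a ha b hb => (huniq a ha).trans (huniq b hb).symm) hμ (hq (n + q) (by omega))
    exact FusionRule.asymptoticallyRankOne_of_tendsto_frequency hd hvh hJ hρ
  · intro hone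
    obtain ⟨μ, hμ, -⟩ := FusionRule.exists_mem_invariantMeasures_tendsto hd hvh hJ (hyperfilter ℕ)
      (N := id) (Nat.hyperfilter_le_atTop) (fun a => Classical.choice (hJ a)) fun _ => T₀
    exact ⟨μ, hμ, fun ν hν =>
      FusionRule.subsingleton_invariantMeasures hd hprim hvh hrec hone hν hμ⟩
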